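/- For a metric space $X$, a point $x\in X$ and $t\ge 0$ let the module of 1-contractibility $\rho(t,x)\in[0,\infty]$ be the infimum of all real $r\ge t$ such that every loop in the open ball $B_t(x)$ is contractible in $B_r(x)$ (and $\infty$ if there is no such $r$). Note that $\rho(0,x)=0$. A family of functions $g_a:[0,\infty)\to[0,\infty]$ with $g_a(0)=0$ is called equally continuous at $0$ if for every $\varepsilon>0$ there is $\delta>0$ with $g_a(t)\le\varepsilon$ for all $a$ and all $0\le t<\delta$. Let $(X_i,p_i)$, $i\in\mathbb N$, be pointed length metric spaces such that the closure of $B_2(p_i)$ is compact, and let $(X,p)$ be a pointed metric space such that the closure of $B_2(p)$ is complete (for instance, $X$ complete). Suppose that $(X_i,p_i)\to(X,p)$ in the Gromov–Hausdorff sense at least on the balls of radius $2$: there are maps $f_i:B_2(p_i)\to X$ such that for every $\varepsilon>0$ and all large $i$ one has $d(f_i(p_i),p)\le\varepsilon$, $|d(f_i(x),f_i(y))-d(x,y)|\le\varepsilon$ for all $x,y\in B_2(p_i)$, and every point of $B_{2-\varepsilon}(p)$ is at distance at most $\varepsilon$ from $f_i(B_2(p_i))$. Fix such maps, and say that points $x_i\in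 B_2(p_i)$ converge to $x\in X$ if $f_i(x_i)\to x$. A point $x\in X$ is of type I if for $x_i\to x$ there is $r>0$ such that the family $\{\rho(\cdot,z): z\in B_r(x_i),\ i\in\mathbb N\}$ is equally continuous at $0$; it is of type II if there are $x_i\to x$ such that the family $\{\rho(\cdot,x_i)\}_{i\in\mathbb N}$ is not equally continuous at $0$; it is of type III if it is neither of type I nor of type II. Suppose that $\lim_{t\to0}\rho(t,x)=0$ for every type II point $x\in B_{3/2}(p)$. Then $\lim_{t\to0}\rho(t,x)=0$ for every type III point $x\in B_1(p)$. Consequently, $\lim_{t\to0}\rho(t,x)=0$ for every $x\in B_1(p)$. -/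

import Mathlib

open Set Filter Topology
open scoped ENNReal unitInterval

namespace RicciLimit

universe u v w

/-- A length (metric) space: the distance between any two points is the infimum of the lengths
of the continuous curves joining them. -/
def IsLengthSpace (X : Type u) [MetricSpace X] : Prop :=
  ∀ x y : X, ⨅ γ : Path x y, eVariationOn (fun s : I => γ s) univ = edist x y

/-- The loop `γ` is contractible in the set `U`: it is null-homotopic (relative to its base point)
through a homotopy with values in `U`. -/
def LoopContractibleIn {X : Type u} [TopologicalSpace X] {y : X} (γ : Path y y) (U : Set X) :
    Prop :=
  ∃ H : Path.Homotopy γ (Path.refl y), ∀ z : I × I, H z ∈ U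

/-- The module of 1-contractibility `ρ(t,x)`: the infimum in `[0,∞]` of the real numbers `r ≥ t`
such that every loop in the open ball `B_t(x)` is contractible in the open ball `B_r(x)`
(and `∞` if there is no such `r`). -/
noncomputable def contractibilityModule {X : Type u} [MetricSpace X] (t : ℝ) (x : X) : ℝ≥0∞ :=
  sInf {a : ℝ≥0∞ | ∃ r : ℝ, a = ENNReal.ofReal r ∧ t ≤ r ∧
    ∀ (y : X) (γ : Path y y), range γ ⊆ Metric.ball x t →
      LoopContractibleIn γ (Metric.ball x r)}

theorem contractibilityModule_zero {X : Type u} [MetricSpace X] (x : X) :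
    contractibilityModule 0 x = 0 := by
  refine le_antisymm (sInf_le ⟨0, by simp, le_refl _, fun y γ h => ?_⟩) bot_le
  have h0 := h (mem_range_self (0 : I))
  simp at h0

/-- `lim_{t → 0} ρ(t,x) = 0`. -/
def ModuleTendsToZero {X : Type u} [MetricSpace X] (x : X) : Prop :=
  Tendsto (fun t : ℝ => contractibilityModule t x) (𝓝[>] 0) (𝓝 0)

/-- A family of functions `g a : [0,∞) → [0,∞]`, all with `g a 0 = 0`, is equally continuous
(equicontinuous) at `t = 0`.  By `contractibilityModule_zero` the normalization `g a 0 = 0` holds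
for the functions `ρ(·,x)`. -/
def EquallyContinuousAtZero {ι : Type w} (g : ι → ℝ → ℝ≥0∞) : Prop :=
  ∀ ε : ℝ≥0∞, 0 < ε → ∃ δ : ℝ, 0 < δ ∧ ∀ a : ι, ∀ t : ℝ, 0 ≤ t → t < δ → g a t ≤ ε

/-- `f` restricts to a pointed Gromov-Hausdorff `ε`-approximation from the ball `B_R(p)` to the
ball of the same radius around `q`. The values of `f` outside `B_R(p)` play no role. -/
structure IsGHApproximation {X : Type u} {Y : Type v} [MetricSpace X] [MetricSpace Y]
    (p : X) (q : Y) (R ε : ℝ) (f : X → Y) : Prop where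
  base : dist (f p) q ≤ ε
  distortion : ∀ x ∈ Metric.ball p R, ∀ y ∈ Metric.ball p R,
    |dist (f x) (f y) - dist x y| ≤ ε
  almost_onto : ∀ y ∈ Metric.ball q (R - ε), ∃ x ∈ Metric.ball p R, dist (f x) y ≤ ε

/-- The pointed balls `B_R(p i)` converge to `B_R(q)` in the Gromov-Hausdorff sense, the
convergence being realized by the approximations `f i`. -/
def GHConvergesOnBall {X : ℕ → Type u} {Y : Type v} [∀ i, MetricSpace (X i)] [MetricSpace Y]
    (p : ∀ i, X i) (q : Y) (R : ℝ) (f : ∀ i, X i → Y) : Prop :=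
  ∀ ε : ℝ, 0 < ε → ∀ᶠ i in atTop, IsGHApproximation (p i) q R ε (f i)

section Types

variable {X : ℕ → Type u} {Y : Type v} [∀ i, MetricSpace (X i)] [MetricSpace Y]

/-- The points `x i` of the balls `B_R(p i)` converge to the point `y` of the limit space, with
respect to the approximations `f i`. -/
def PointsConverge (p : ∀ i, X i) (R : ℝ) (f : ∀ i, X i → Y) (x : ∀ i, X i) (y : Y) : Prop :=
  (∀ i, x i ∈ Metric.ball (p i) R) ∧ Tendsto (fun i => f i (x i)) atTop (𝓝 y)

/-- Type I: for `x i` converging to `y` there is `r > 0` such that the family of all `ρ(·,z)` with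
`z ∈ B_r(x i)`, `i ∈ ℕ`, is equally continuous at `0`. -/
def IsTypeI (p : ∀ i, X i) (R : ℝ) (f : ∀ i, X i → Y) (y : Y) : Prop :=
  ∀ x : ∀ i, X i, PointsConverge p R f x y → ∃ r : ℝ, 0 < r ∧
    EquallyContinuousAtZero
      (fun (a : Σ i, Metric.ball (x i) r) (t : ℝ) => contractibilityModule t (a.2 : X a.1))

/-- Type II: for some `x i` converging to `y` the family `ρ(·, x i)`, `i ∈ ℕ`, is not equally
continuous at `0`. -/
def IsTypeII (p : ∀ i, X i) (R : ℝ) (f : ∀ i, X i → Y) (y : Y) : Prop :=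
  ∃ x : ∀ i, X i, PointsConverge p R f x y ∧
    ¬ EquallyContinuousAtZero (fun (i : ℕ) (t : ℝ) => contractibilityModule t (x i))

/-- Type III: neither of type I nor of type II. -/
def IsTypeIII (p : ∀ i, X i) (R : ℝ) (f : ∀ i, X i → Y) (y : Y) : Prop :=
  ¬ IsTypeI p R f y ∧ ¬ IsTypeII p R f y

end Types

end RicciLimit

/-! A small loop is a map of the boundary of a square, and contracting it amounts to extending this
map over the square. At a type II point small loops contract by hypothesis. At any other point `z`
the modules of the `X i` are equally continuous along a sequence converging to `z`, so boundary maps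
can be lifted to `X i` and filled there. The filling, however, returns to `Y` only through `f i`,
which need not be continuous.

What survives the passage to the limit is the property `Refinable`: on all fine enough grids, a
boundary map extends continuously to the grid lines, with values near `z` and with arbitrarily small
oscillation on the cells. For this the image of the filling is given the prescribed boundary values
and is corrected along the grid lines by short geodesics of `Y`
(`GHConvergesOnBall.exists_refinable_of_not_isTypeII`). Such geodesics exist because balls of `Y` of
radius less than 2 are compact and midpoints pass to the limit. At type II points a genuine filling
gives the same property (`ModuleTendsToZero.exists_refinable`), so the two kinds of points need no
further distinction.

By compactness the scale of refinability is uniform (`exists_uniform_refinable`). Hence refinement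
can be iterated: on the boundary of each cell the map is again a small boundary map, to be refined
at the next scale (`exists_refinement`). The displacements are summable and the oscillations tend to
zero, so these maps, though discontinuous inside the cells, converge uniformly to a continuous
filling (`exists_filling_of_refinable`). -/

namespace RicciLimit

/-! ### Subdivisions of the unit interval and interpolation along them -/

/-- The `j`-th interval of the subdivision of `[0,1]` into `N` equal parts. -/
def unitCell (N j : ℕ) : Set ℝ := Icc ((j : ℝ) / N) ((j + 1 : ℝ) / N)

/-- The index of a cell containing `s`. -/
noncomputable def cellIndex (N : ℕ) (s : ℝ) : ℕ := min ⌊N * s⌋₊ (N - 1)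

theorem mem_unitCell_iff {N j : ℕ} (hN : 0 < N) {s : ℝ} :
    s ∈ unitCell N j ↔ (j : ℝ) ≤ N * s ∧ N * s ≤ j + 1 := by
  have : (0 : ℝ) < N := by exact_mod_cast hN
  rw [unitCell, mem_Icc, div_le_iff₀ this, le_div_iff₀ this, mul_comm s]

theorem unitCell_subset {N j : ℕ} (hj : j < N) : unitCell N j ⊆ Icc 0 1 := by
  intro s hs
  have hN : 0 < N := by omega
  have h0 : (0 : ℝ) < N := by exact_mod_cast hN
  have h1 : (j + 1 : ℝ) ≤ N := by exact_mod_cast hj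
  refine ⟨le_trans (by positivity) hs.1, hs.2.trans ?_⟩
  rw [div_le_one h0]; exact h1

theorem left_mem_unitCell {N : ℕ} (hN : 0 < N) (j : ℕ) : (j : ℝ) / N ∈ unitCell N j := by
  have h0 : (0 : ℝ) < N := by exact_mod_cast hN
  exact ⟨le_rfl, by gcongr; linarith⟩

theorem right_mem_unitCell {N : ℕ} (hN : 0 < N) (j : ℕ) :
    ((j + 1 : ℕ) : ℝ) / N ∈ unitCell N j := by
  have h0 : (0 : ℝ) < N := by exact_mod_cast hN
  exact ⟨by gcongr; linarith, by push_cast; rfl⟩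

theorem div_mem_unitInterval {N k : ℕ} (hk : k ≤ N) : (k : ℝ) / N ∈ Icc (0 : ℝ) 1 :=
  ⟨by positivity, div_le_one_of_le₀ (by exact_mod_cast hk) (by positivity)⟩

theorem cellIndex_lt {N : ℕ} (hN : 0 < N) (s : ℝ) : cellIndex N s < N := by
  unfold cellIndex; omega

theorem mem_unitCell_cellIndex {N : ℕ} (hN : 0 < N) {s : ℝ} (hs : s ∈ Icc (0 : ℝ) 1) :
    s ∈ unitCell N (cellIndex N s) := by
  have h0 : (0 : ℝ) < N := by exact_mod_cast hN
  rw [mem_unitCell_iff hN]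
  have h1 : 0 ≤ N * s := mul_nonneg h0.le hs.1
  have h2 : N * s ≤ N := by nlinarith [hs.2]
  have h3 := Nat.floor_le h1
  have h4 := Nat.lt_floor_add_one (N * s)
  rcases le_total ⌊N * s⌋₊ (N - 1) with h | h
  · rw [cellIndex, min_eq_left h]; exact ⟨h3, h4.le⟩
  · rw [cellIndex, min_eq_right h]
    have h5 : ((N - 1 : ℕ) : ℝ) ≤ ⌊N * s⌋₊ := by exact_mod_cast h
    refine ⟨h5.trans h3, ?_⟩
    rw [Nat.cast_sub hN]; push_cast; linarith

/-- Adjacent cells share an endpoint, which the floor assigns to the right-hand cell. The truncation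
at `N - 1` keeps the point 1 in the last cell. -/
theorem cellIndex_eq_or {N j : ℕ} (hj : j < N) {s : ℝ} (hs : s ∈ unitCell N j) :
    cellIndex N s = j ∨ cellIndex N s = j + 1 ∧ N * s = j + 1 := by
  have hN : 0 < N := by omega
  have hI := unitCell_subset hj hs
  have h0 : (0 : ℝ) < N := by exact_mod_cast hN
  rw [mem_unitCell_iff hN] at hs
  rcases hs.2.lt_or_eq with h | h
  · left
    have : ⌊N * s⌋₊ = j := (Nat.floor_eq_iff (by nlinarith [hI.1])).2 ⟨hs.1, h⟩
    rw [cellIndex, this]; omega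
  · have : ⌊N * s⌋₊ = j + 1 := by
      rw [h]; exact_mod_cast Nat.floor_natCast (R := ℝ) (j + 1)
    rw [cellIndex, this]
    rcases Nat.lt_or_ge (j + 1) N with h' | h'
    · right; exact ⟨by omega, h⟩
    · left; omega

theorem continuousOn_of_unitCell {Z : Type*} [TopologicalSpace Z] {N : ℕ} (hN : 0 < N) {g : ℝ → Z}
    (h : ∀ j < N, ContinuousOn g (unitCell N j)) : ContinuousOn g (Icc 0 1) := by
  have h0 : (0 : ℝ) < N := by exact_mod_cast hN
  have key : ∀ n ≤ N, ContinuousOn g (Icc 0 ((n : ℝ) / N)) := by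
    intro n
    induction n with
    | zero => intro _; simp
    | succ n ih =>
      intro hn
      have h1 := (ih (by omega)).union_of_isClosed (h n (by omega)) isClosed_Icc isClosed_Icc
      refine h1.mono ?_
      rw [unitCell, Icc_union_Icc_eq_Icc (by positivity) (by gcongr; linarith)]
      push_cast; rfl
  have := key N le_rfl
  rwa [div_self h0.ne'] at this

/-- A function on `[0,1]` of small oscillation on the intervals of a subdivision is close to a
continuous function agreeing with it at the points of the subdivision, provided that successive
values can be joined by small curves. -/
theorem exists_continuous_interpolation {Z : Type*} [MetricSpace Z] {N : ℕ} (hN : 0 < N)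
    {r η : ℝ} (F : ℝ → Z)
    (hosc : ∀ j < N, ∀ s ∈ unitCell N j, dist (F (j / N)) (F s) ≤ η)
    (hjoin : ∀ j < N, ∃ e : Path (F ((j : ℕ) / N)) (F ((j + 1 : ℕ) / N)),
      ∀ s, dist (e s) (F (j / N)) ≤ r) :
    ∃ g : ℝ → Z, ContinuousOn g (Icc 0 1) ∧ (∀ j ≤ N, g (j / N) = F (j / N)) ∧
      ∀ s ∈ Icc (0 : ℝ) 1, dist (g s) (F s) ≤ r + η := by
  have h0 : (0 : ℝ) < N := by exact_mod_cast hN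
  have : ∀ j : ℕ, ∃ E : ℝ → Z, j < N → Continuous E ∧ E 0 = F (j / N) ∧
      E 1 = F ((j + 1 : ℕ) / N) ∧ ∀ s, dist (E s) (F (j / N)) ≤ r := by
    intro j
    by_cases hj : j < N
    · obtain ⟨e, he⟩ := hjoin j hj
      exact ⟨e.extend, fun _ => ⟨e.continuous_extend, e.extend_zero, e.extend_one,
        fun s => he _⟩⟩
    · exact ⟨F, fun h => absurd h hj⟩
  choose E hE using this
  set g : ℝ → Z := fun s => E (cellIndex N s) (N * s - cellIndex N s) with hg
  have hcell : ∀ j < N, ∀ s ∈ unitCell N j, g s = E j (N * s - j) := by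
    intro j hj s hs
    rcases cellIndex_eq_or hj hs with h | ⟨h, h'⟩
    · rw [hg]; simp only [h]
    -- At the common endpoint of two cells the piece `E j` has just ended where `E (j + 1)` starts.
    · have h2 : j + 1 < N := h ▸ cellIndex_lt hN s
      simp only [hg, h, h']
      have e1 : (j : ℝ) + 1 - (j + 1 : ℕ) = 0 := by push_cast; ring
      have e2 : (j : ℝ) + 1 - j = 1 := by ring
      rw [e1, e2, (hE _ h2).2.1, (hE _ hj).2.2.1]
  refine ⟨g, continuousOn_of_unitCell hN fun j hj => ?_, fun j hj => ?_, fun s hs => ?_⟩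
  · refine ContinuousOn.congr ?_ (hcell j hj)
    exact ((hE j hj).1.comp (by fun_prop)).continuousOn
  · rcases Nat.lt_or_ge j N with h | h
    · rw [hcell j h _ (left_mem_unitCell hN j), mul_div_cancel₀ _ h0.ne', sub_self,
        (hE j h).2.1]
    · obtain ⟨m, rfl⟩ : ∃ m, N = m + 1 := ⟨N - 1, by omega⟩
      have : j = m + 1 := by omega
      subst this
      rw [hcell m (by omega) _ (right_mem_unitCell hN m), mul_div_cancel₀ _ h0.ne',
        ← (hE m (by omega)).2.2.1]
      congr 1; push_cast; ring
  · have h1 := mem_unitCell_cellIndex hN hs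
    have h2 := cellIndex_lt hN s
    rw [hcell _ h2 s h1]
    exact (dist_triangle _ _ _).trans (add_le_add ((hE _ h2).2.2.2 _) (hosc _ h2 s h1))

/-! ### Maps of the square that are continuous along a grid -/

/-- Points of the boundary of the unit square. -/
def OnBoundary (s t : ℝ) : Prop := s = 0 ∨ s = 1 ∨ t = 0 ∨ t = 1

/-- `v` is continuous along the lines of the subdivision of the unit square into `N × N` cells. -/
def GridContinuous {Z : Type*} [TopologicalSpace Z] (N : ℕ) (v : ℝ → ℝ → Z) : Prop :=
  ∀ k ≤ N, ContinuousOn (fun s => v s (k / N)) (Icc 0 1) ∧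
    ContinuousOn (fun t => v (k / N) t) (Icc 0 1)

/-- The oscillation of `v` on the cells of the `N × N` subdivision is at most `η`. -/
def CellOscillationLE {Z : Type*} [MetricSpace Z] (N : ℕ) (η : ℝ) (v : ℝ → ℝ → Z) : Prop :=
  ∀ i < N, ∀ j < N, ∀ s ∈ unitCell N i, ∀ s' ∈ unitCell N i, ∀ t ∈ unitCell N j,
    ∀ t' ∈ unitCell N j, dist (v s t) (v s' t') ≤ η

/-- A function on the square with small oscillation on the cells is close to one which is also
continuous on the grid lines, if close points can be joined by small curves. -/
theorem exists_gridContinuous {Z : Type*} [MetricSpace Z] {N : ℕ} (hN : 0 < N) {r η : ℝ}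
    (hr : 0 ≤ r) (F : ℝ → ℝ → Z)
    (hbd : GridContinuous 1 F) (hosc : CellOscillationLE N η F)
    (hjoin : ∀ s ∈ Icc (0 : ℝ) 1, ∀ t ∈ Icc (0 : ℝ) 1, ∀ s' ∈ Icc (0 : ℝ) 1,
      ∀ t' ∈ Icc (0 : ℝ) 1, dist (F s t) (F s' t') ≤ η →
      ∃ e : Path (F s t) (F s' t'), ∀ x, dist (e x) (F s t) ≤ r) :
    ∃ v : ℝ → ℝ → Z, GridContinuous N v ∧
      (∀ s ∈ Icc (0 : ℝ) 1, ∀ t ∈ Icc (0 : ℝ) 1, OnBoundary s t → v s t = F s t) ∧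
      ∀ s ∈ Icc (0 : ℝ) 1, ∀ t ∈ Icc (0 : ℝ) 1, dist (v s t) (F s t) ≤ r + η := by
  have h0 : (0 : ℝ) < N := by exact_mod_cast hN
  have h00 : (0 : ℝ) ∈ unitCell N 0 := by simpa using left_mem_unitCell hN 0
  have hη : 0 ≤ η := by
    simpa using hosc 0 hN 0 hN 0 h00 0 h00 0 h00 0 h00
  have hcellI : ∀ t ∈ Icc (0 : ℝ) 1, ∃ k < N, t ∈ unitCell N k := fun t ht =>
    ⟨_, cellIndex_lt hN t, mem_unitCell_cellIndex hN ht⟩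
  have hG : ∀ k : ℕ, ∃ g : ℝ → Z, k ≤ N → ContinuousOn g (Icc 0 1) ∧
      (∀ j ≤ N, g (j / N) = F (j / N) (k / N)) ∧
      (∀ s ∈ Icc (0 : ℝ) 1, dist (g s) (F s (k / N)) ≤ r + η) ∧
      (k = 0 ∨ k = N → ∀ s, g s = F s (k / N)) := by
    intro k
    by_cases hk : k ≤ N
    swap
    · exact ⟨fun s => F s 0, fun h => absurd h hk⟩
    by_cases hk0 : k = 0 ∨ k = N
    · refine ⟨fun s => F s (k / N), fun _ => ⟨?_, fun _ _ => rfl, fun s _ => ?_, fun _ _ => rfl⟩⟩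
      · rcases hk0 with rfl | rfl
        · simpa using (hbd 0 (by omega)).1
        · simpa [div_self h0.ne'] using (hbd 1 (by omega)).1
      · simpa using add_nonneg hr hη
    -- Any row of cells containing the line controls the oscillation of `F` along it. The lines on
    -- the boundary were left unchanged above.
    · obtain ⟨j, hj, hkj⟩ := hcellI _ (div_mem_unitInterval hk)
      obtain ⟨g, hg⟩ := exists_continuous_interpolation (r := r) (η := η) hN (fun s => F s (k / N))
        (fun i hi s hs => hosc i hi j hj _ (left_mem_unitCell hN i) _ hs _ hkj _ hkj)
        (fun i hi => hjoin _ (div_mem_unitInterval hi.le) _ (div_mem_unitInterval hk) _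
          (div_mem_unitInterval hi) _ (div_mem_unitInterval hk)
          (hosc i hi j hj _ (left_mem_unitCell hN i) _ (right_mem_unitCell hN i) _ hkj _ hkj))
      exact ⟨g, fun _ => ⟨hg.1, hg.2.1, hg.2.2, fun h => absurd h hk0⟩⟩
  have hH : ∀ k : ℕ, ∃ g : ℝ → Z, k ≤ N → ContinuousOn g (Icc 0 1) ∧
      (∀ j ≤ N, g (j / N) = F (k / N) (j / N)) ∧
      (∀ s ∈ Icc (0 : ℝ) 1, dist (g s) (F (k / N) s) ≤ r + η) ∧
      (k = 0 ∨ k = N → ∀ s, g s = F (k / N) s) := by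
    intro k
    by_cases hk : k ≤ N
    swap
    · exact ⟨fun s => F s 0, fun h => absurd h hk⟩
    by_cases hk0 : k = 0 ∨ k = N
    · refine ⟨fun s => F (k / N) s, fun _ => ⟨?_, fun _ _ => rfl, fun s _ => ?_, fun _ _ => rfl⟩⟩
      · rcases hk0 with rfl | rfl
        · simpa using (hbd 0 (by omega)).2
        · simpa [div_self h0.ne'] using (hbd 1 (by omega)).2
      · simpa using add_nonneg hr hη
    · obtain ⟨j, hj, hkj⟩ := hcellI _ (div_mem_unitInterval hk)
      obtain ⟨g, hg⟩ := exists_continuous_interpolation (r := r) (η := η) hN (fun s => F (k / N) s)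
        (fun i hi s hs => hosc j hj i hi _ hkj _ hkj _ (left_mem_unitCell hN i) _ hs)
        (fun i hi => hjoin _ (div_mem_unitInterval hk) _ (div_mem_unitInterval hi.le) _
          (div_mem_unitInterval hk) _ (div_mem_unitInterval hi)
          (hosc j hj i hi _ hkj _ hkj _ (left_mem_unitCell hN i) _ (right_mem_unitCell hN i)))
      exact ⟨g, fun _ => ⟨hg.1, hg.2.1, hg.2.2, fun h => absurd h hk0⟩⟩
  choose g hg using hG
  choose h hh using hH
  classical
  -- Horizontal lines take precedence over vertical ones. This is harmless, since `g` and `h` both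
  -- equal `F` at the nodes; off the grid `F` is kept.
  set v : ℝ → ℝ → Z := fun s t =>
    if (⌊N * t⌋₊ : ℝ) = N * t then g ⌊N * t⌋₊ s
    else if (⌊N * s⌋₊ : ℝ) = N * s then h ⌊N * s⌋₊ t else F s t with hv
  have hfl' : ∀ k : ℕ, (N : ℝ) * (k / N) = k := fun k => mul_div_cancel₀ _ h0.ne'
  have hfloor : ∀ t ∈ Icc (0 : ℝ) 1, (⌊N * t⌋₊ : ℝ) = N * t →
      ∃ k ≤ N, t = k / N := by
    intro t ht h
    refine ⟨⌊N * t⌋₊, ?_, ?_⟩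
    · have : (⌊N * t⌋₊ : ℝ) ≤ N := by rw [h]; nlinarith [ht.2]
      exact_mod_cast this
    · rw [h, mul_div_cancel_left₀ _ h0.ne']
  have vg : ∀ k ≤ N, ∀ s, v s (k / N) = g k s := by
    intro k _ s
    simp only [hv, hfl', Nat.floor_natCast, if_true]
  have vh : ∀ k ≤ N, ∀ t ∈ Icc (0 : ℝ) 1, v (k / N) t = h k t := by
    intro k hk t ht
    by_cases htN : (⌊N * t⌋₊ : ℝ) = N * t
    · obtain ⟨j, hj, rfl⟩ := hfloor t ht htN
      rw [vg j hj, (hg j hj).2.1 k hk, (hh k hk).2.1 j hj]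
    · simp only [hv, if_neg htN, hfl', Nat.floor_natCast, if_true]
  have e1 : (1 : ℝ) = (N : ℕ) / N := (div_self h0.ne').symm
  have e0 : (0 : ℝ) = (0 : ℕ) / N := by simp
  refine ⟨v, fun k hk => ⟨?_, ?_⟩, fun s hs t ht hst => ?_, fun s hs t ht => ?_⟩
  · exact (hg k hk).1.congr fun s _ => vg k hk s
  · exact (hh k hk).1.congr fun s hs => vh k hk s hs
  · rcases hst with rfl | rfl | rfl | rfl
    · rw [e0, vh 0 (by omega) t ht, (hh 0 (by omega)).2.2.2 (.inl rfl)]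
    · rw [e1, vh N le_rfl t ht, (hh N le_rfl).2.2.2 (.inr rfl)]
    · rw [e0, vg 0 (by omega), (hg 0 (by omega)).2.2.2 (.inl rfl)]
    · rw [e1, vg N le_rfl, (hg N le_rfl).2.2.2 (.inr rfl)]
  · by_cases htN : (⌊N * t⌋₊ : ℝ) = N * t
    · obtain ⟨j, hj, rfl⟩ := hfloor t ht htN
      rw [vg j hj]; exact (hg j hj).2.2.1 s hs
    by_cases hsN : (⌊N * s⌋₊ : ℝ) = N * s
    · obtain ⟨j, hj, rfl⟩ := hfloor s hs hsN
      rw [vh j hj t ht]; exact (hh j hj).2.2.1 t ht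
    · simp only [hv, if_neg htN, if_neg hsN, dist_self]; exact add_nonneg hr hη

/-! ### Filling a square from a contraction of its boundary loop -/

/-- A homotopy rel endpoints is constant near the endpoints up to a small error. -/
theorem tendsto_homotopy_of_tendsto_endpoint {Z α : Type*} [TopologicalSpace Z] {z : Z}
    (K : I × I → Z) (hK : Continuous K) {e : I} (he : ∀ τ, K (τ, e) = z) {l : Filter α}
    (τ : α → I) {m : α → I} (hm : Tendsto m l (𝓝 e)) :
    Tendsto (fun a => K (τ a, m a)) l (𝓝 z) := by
  rw [tendsto_nhds]
  intro V hV hz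
  -- The parameter `τ` is arbitrary, so the neighbourhood of `e` must be uniform in the first
  -- variable.
  obtain ⟨A, B, -, hB, hA, heB, hAB⟩ := generalized_tube_lemma (isCompact_univ (X := I))
    (isCompact_singleton (x := e)) (hV.preimage hK) (by
      rintro ⟨a, b⟩ ⟨-, hb⟩
      obtain rfl : b = e := hb
      rw [mem_preimage, he]; exact hz)
  filter_upwards [hm (hB.mem_nhds (heB rfl))] with a ha
  exact hAB ⟨hA (mem_univ _), ha⟩

/-- The transverse parameter for filling the square by a homotopy between the two boundary paths
from `(0,0)` to `(1,1)`. -/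
noncomputable def squareParam (x y : ℝ) : ℝ := y * (1 - x) / (y * (1 - x) + x * (1 - y))

theorem squareParam_mem {x y : ℝ} (hx : x ∈ I) (hy : y ∈ I) : squareParam x y ∈ I := by
  have h1 : 0 ≤ y * (1 - x) := mul_nonneg hy.1 (by linarith [hx.2])
  have h2 : 0 ≤ x * (1 - y) := mul_nonneg hx.1 (by linarith [hy.2])
  exact ⟨div_nonneg h1 (by positivity), div_le_one_of_le₀ (by linarith) (by positivity)⟩

/-- If the two boundary paths of a square are homotopic, the square can be filled. -/
theorem exists_square_of_homotopy {Z : Type*} [TopologicalSpace Z] {a b c d : Z}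
    (p : Path a b) (r : Path b d) (l : Path a c) (t : Path c d)
    (K : (p.trans r).Homotopy (l.trans t)) :
    ∃ F : I × I → Z, Continuous F ∧ (∀ x, F (x, 0) = p x) ∧ (∀ y, F (1, y) = r y) ∧
      (∀ y, F (0, y) = l y) ∧ ∀ x, F (x, 1) = t x := by
  -- `m` is the time along the boundary paths, constant on antidiagonals; `τ` is the homotopy
  -- parameter, 0 on the bottom and right sides and 1 on the left and top sides, apart from the
  -- corners `(0,0)` and `(1,1)`. It is discontinuous only at these two corners, where `K` does not
  -- depend on it.
  set τ : I × I → I := fun z => ⟨squareParam z.1 z.2, squareParam_mem z.1.2 z.2.2⟩ with hτ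
  set m : I × I → I := fun z => ⟨((z.1 : ℝ) + z.2) / 2,
    by linarith [z.1.2.1, z.2.2.1], by linarith [z.1.2.2, z.2.2.2]⟩ with hm
  have hmc : Continuous m := by
    rw [hm]; exact Continuous.subtype_mk (by fun_prop) _
  have hKc : Continuous K := K.continuous
  refine ⟨fun z => K (τ z, m z), ?_, fun x => ?_, fun y => ?_, fun y => ?_, fun x => ?_⟩
  · rw [continuous_iff_continuousAt]
    rintro ⟨x, y⟩
    by_cases h0 : m (x, y) = 0
    · have := tendsto_homotopy_of_tendsto_endpoint K hKc (e := 0) (z := a) (by simp) τ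
        (m := m) (l := 𝓝 (x, y)) (by rw [← h0]; exact hmc.continuousAt)
      simpa [ContinuousAt, h0] using this
    by_cases h1 : m (x, y) = 1
    · have := tendsto_homotopy_of_tendsto_endpoint K hKc (e := 1) (z := d) (by simp) τ
        (m := m) (l := 𝓝 (x, y)) (by rw [← h1]; exact hmc.continuousAt)
      simpa [ContinuousAt, h1] using this
    refine hKc.continuousAt.comp (ContinuousAt.prodMk ?_ hmc.continuousAt)
    rw [Topology.IsInducing.subtypeVal.continuousAt_iff]
    refine ContinuousAt.div (by fun_prop) (by fun_prop) ?_
    intro hz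
    simp only at hz
    have hx := x.2; have hy := y.2
    have e1 : 0 ≤ (y : ℝ) * (1 - x) := mul_nonneg hy.1 (by linarith [hx.2])
    have e2 : 0 ≤ (x : ℝ) * (1 - y) := mul_nonneg hx.1 (by linarith [hy.2])
    have e3 : (x : ℝ) = y := by nlinarith
    have e4 : (y : ℝ) * (1 - y) = 0 := by rw [e3] at e1 hz; linarith
    rcases mul_eq_zero.1 e4 with h | h
    · exact h0 (Subtype.ext (by simp [hm, e3, h]))
    · exact h1 (Subtype.ext (by simp [hm, e3, show (y : ℝ) = 1 by linarith]))
  · have h1 : τ (x, 0) = 0 := Subtype.ext (by simp [hτ, squareParam])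
    have h2 : (m (x, 0) : ℝ) = x / 2 := by simp [hm]
    simp only [h1]
    rw [K.apply_zero, Path.coe_toContinuousMap, Path.trans_apply, dif_pos (by rw [h2]; linarith [x.2.2])]
    congr 1; ext; simp only [h2]; ring
  · have h1 : τ (1, y) = 0 := Subtype.ext (by simp [hτ, squareParam])
    have h2 : (m (1, y) : ℝ) = (1 + y) / 2 := by simp [hm]
    simp only [h1]
    rw [K.apply_zero, Path.coe_toContinuousMap, ← Path.extend_apply _ (m (1, y)).2,
      Path.extend_trans_of_half_le _ _ (by rw [h2]; linarith [y.2.1]), h2,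
      show 2 * ((1 + (y : ℝ)) / 2) - 1 = y by ring, Path.extend_apply _ y.2]
  -- At this corner `squareParam` is `0 / 0 = 0` instead of 1, but `m = 0` makes the value
  -- irrelevant.
  · by_cases hy : (y : ℝ) = 0
    · have hy' : y = 0 := Subtype.ext hy
      have h2 : m (0, y) = 0 := Subtype.ext (by simp [hm, hy])
      simp only [h2]
      rw [K.source, hy', l.source]
    have h1 : τ (0, y) = 1 := Subtype.ext (by simp [hτ, squareParam, hy])
    have h2 : (m (0, y) : ℝ) = y / 2 := by simp [hm]
    simp only [h1]
    rw [K.apply_one, Path.coe_toContinuousMap, Path.trans_apply, dif_pos (by rw [h2]; linarith [y.2.2])]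
    congr 1; ext; simp only [h2]; ring
  · by_cases hx : (x : ℝ) = 1
    · have hx' : x = 1 := Subtype.ext hx
      have h2 : m (x, 1) = 1 := Subtype.ext (by simp [hm, hx])
      simp only [h2]
      rw [K.target, hx', t.target]
    have h1 : τ (x, 1) = 1 := Subtype.ext (by
      simp [hτ, squareParam, sub_ne_zero.2 (Ne.symm hx)])
    have h2 : (m (x, 1) : ℝ) = (x + 1) / 2 := by simp [hm]
    simp only [h1]
    rw [K.apply_one, Path.coe_toContinuousMap, ← Path.extend_apply _ (m (x, 1)).2,
      Path.extend_trans_of_half_le _ _ (by rw [h2]; linarith [x.2.1]), h2,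
      show 2 * (((x : ℝ) + 1) / 2) - 1 = x by ring, Path.extend_apply _ x.2]

/-- The filling of a square inside `U` when the boundary loop contracts in `U`. -/
theorem exists_square_of_loopContractibleIn {Z : Type*} [TopologicalSpace Z] {U : Set Z}
    {a b c d : Z} (p : Path a b) (r : Path b d) (l : Path a c) (t : Path c d)
    (h : LoopContractibleIn ((p.trans r).trans (l.trans t).symm) U) :
    ∃ F : I × I → Z, Continuous F ∧ (∀ x, F (x, 0) = p x) ∧ (∀ y, F (1, y) = r y) ∧
      (∀ y, F (0, y) = l y) ∧ (∀ x, F (x, 1) = t x) ∧ ∀ z, F z ∈ U := by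
  obtain ⟨H, hH⟩ := h
  have hU : ∀ s, ((p.trans r).trans (l.trans t).symm) s ∈ U := fun s => by
    have := hH (0, s); rwa [H.apply_zero] at this
  have hr : range ((p.trans r).trans (l.trans t).symm) ⊆ U := range_subset_iff.2 hU
  simp only [Path.trans_range, Path.symm_range, union_subset_iff, range_subset_iff] at hr
  obtain ⟨⟨hp, hr⟩, hl, ht⟩ := hr
  have ha : a ∈ U := by simpa using hp 0
  have hb : b ∈ U := by simpa using hp 1
  have hc : c ∈ U := by simpa using hl 1
  have hd : d ∈ U := by simpa using ht 1
  -- In the subtype `U` the usual algebra of homotopy classes automatically keeps every homotopy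
  -- inside `U`.
  let p' : Path (⟨a, ha⟩ : U) ⟨b, hb⟩ := ⟨⟨fun s => ⟨p s, hp s⟩, by fun_prop⟩, by simp, by simp⟩
  let r' : Path (⟨b, hb⟩ : U) ⟨d, hd⟩ := ⟨⟨fun s => ⟨r s, hr s⟩, by fun_prop⟩, by simp, by simp⟩
  let l' : Path (⟨a, ha⟩ : U) ⟨c, hc⟩ := ⟨⟨fun s => ⟨l s, hl s⟩, by fun_prop⟩, by simp, by simp⟩
  let t' : Path (⟨c, hc⟩ : U) ⟨d, hd⟩ := ⟨⟨fun s => ⟨t s, ht s⟩, by fun_prop⟩, by simp, by simp⟩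
  have hmap : ((p'.trans r').trans (l'.trans t').symm).map continuous_subtype_val =
      (p.trans r).trans (l.trans t).symm := by
    rw [Path.map_trans, Path.map_trans, ← Path.map_symm, Path.map_trans]
    rfl
  have hc' : ((p'.trans r').trans (l'.trans t').symm).Homotopic (Path.refl _) := by
    refine ⟨⟨⟨⟨fun z => ⟨H z, hH z⟩, ?_⟩, ?_, ?_⟩, ?_⟩⟩
    · exact H.continuous.subtype_mk _
    · intro s
      refine Subtype.ext ?_
      have := congrArg (fun γ : Path a a => γ s) hmap
      exact (H.apply_zero s).trans this.symm
    · intro s; exact Subtype.ext (by simp)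
    · intro s x hx
      refine Subtype.ext ?_
      rcases hx with rfl | rfl <;> simp
  have hpl : (p'.trans r').Homotopic (l'.trans t') := by
    have h1 := (hc'.hcomp (Path.Homotopic.refl (l'.trans t')))
    refine ((Path.Homotopic.trans_refl _).symm.trans ?_).trans
      (h1.trans (Path.Homotopic.refl_trans _))
    exact ((Path.Homotopic.refl _).hcomp (Path.Homotopic.symm_trans _).symm).trans
      (Path.Homotopic.trans_assoc _ _ _).symm
  obtain ⟨K⟩ := hpl
  obtain ⟨F, hF, h1, h2, h3, h4⟩ := exists_square_of_homotopy p' r' l' t' K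
  exact ⟨fun z => F z, continuous_subtype_val.comp hF, fun x => congrArg Subtype.val (h1 x),
    fun x => congrArg Subtype.val (h2 x), fun x => congrArg Subtype.val (h3 x), fun x => congrArg Subtype.val (h4 x),
    fun z => (F z).2⟩

/-- If loops in `A` contract in `B`, every map of the boundary of the unit square to `A` extends to
a map of the square to `B`. -/
theorem exists_square_filling {Z : Type*} [TopologicalSpace Z] {A B : Set Z}
    (h : ∀ (y : Z) (γ : Path y y), range γ ⊆ A → LoopContractibleIn γ B)
    (u : ℝ → ℝ → Z) (hu : GridContinuous 1 u)
    (hA : ∀ s ∈ Icc (0 : ℝ) 1, ∀ t ∈ Icc (0 : ℝ) 1, OnBoundary s t → u s t ∈ A) :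
    ∃ F : ℝ → ℝ → Z, Continuous (Function.uncurry F) ∧ (∀ s t, F s t ∈ B) ∧
      ∀ s ∈ Icc (0 : ℝ) 1, ∀ t ∈ Icc (0 : ℝ) 1, OnBoundary s t → F s t = u s t := by
  have h0 := hu 0 (by omega)
  have h1 := hu 1 le_rfl
  simp only [Nat.cast_zero, Nat.cast_one, div_one] at h0 h1
  rw [continuousOn_iff_continuous_domRestrict] at h0 h1
  rw [continuousOn_iff_continuous_domRestrict] at h0 h1
  let p : Path (u 0 0) (u 1 0) := ⟨⟨_, h0.1⟩, by simp, by simp⟩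
  let r : Path (u 1 0) (u 1 1) := ⟨⟨_, h1.2⟩, by simp, by simp⟩
  let l : Path (u 0 0) (u 0 1) := ⟨⟨_, h0.2⟩, by simp, by simp⟩
  let t : Path (u 0 1) (u 1 1) := ⟨⟨_, h1.1⟩, by simp, by simp⟩
  have hI0 : (0 : ℝ) ∈ Icc (0 : ℝ) 1 := by simp
  have hI1 : (1 : ℝ) ∈ Icc (0 : ℝ) 1 := by simp
  obtain ⟨F, hF, e1, e2, e3, e4, hB⟩ := exists_square_of_loopContractibleIn p r l t (h _ _ (by
    simp only [Path.trans_range, Path.symm_range, union_subset_iff, range_subset_iff]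
    refine ⟨⟨fun s => ?_, fun s => ?_⟩, fun s => ?_, fun s => ?_⟩
    · exact hA s s.2 0 hI0 (by simp [OnBoundary])
    · exact hA 1 hI1 s s.2 (by simp [OnBoundary])
    · exact hA 0 hI0 s s.2 (by simp [OnBoundary])
    · exact hA s s.2 1 hI1 (by simp [OnBoundary])))
  refine ⟨fun s t => F (projIcc 0 1 zero_le_one s, projIcc 0 1 zero_le_one t), ?_,
    fun s t => hB _, fun s hs x hx hsx => ?_⟩
  · have : Continuous (projIcc (0 : ℝ) 1 zero_le_one) := continuous_projIcc
    exact hF.comp ((this.comp continuous_fst).prodMk (this.comp continuous_snd))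
  · rcases hsx with rfl | rfl | rfl | rfl
    · simp only [projIcc_left, projIcc_of_mem _ hx]; exact e3 ⟨x, hx⟩
    · simp only [projIcc_right, projIcc_of_mem _ hx]; exact e2 ⟨x, hx⟩
    · simp only [projIcc_left, projIcc_of_mem _ hs]; exact e1 ⟨s, hs⟩
    · simp only [projIcc_right, projIcc_of_mem _ hs]; exact e4 ⟨s, hs⟩

/-! ### Refinable points and the iteration of refinements -/

/-- Every map of the boundary of the unit square to the `δ`-ball around `z` extends, for all fine
enough subdivisions of the square, to the grid lines, with values in the `ε`-ball and arbitrarily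
small oscillation on the cells. -/
def Refinable {Z : Type*} [MetricSpace Z] (z : Z) (δ ε : ℝ) : Prop :=
  ∀ u : ℝ → ℝ → Z, GridContinuous 1 u →
    (∀ s ∈ Icc (0 : ℝ) 1, ∀ t ∈ Icc (0 : ℝ) 1, OnBoundary s t → dist (u s t) z < δ) →
    ∀ η > 0, ∀ᶠ N : ℕ in atTop, ∃ v : ℝ → ℝ → Z, GridContinuous N v ∧ CellOscillationLE N η v ∧
      (∀ s ∈ Icc (0 : ℝ) 1, ∀ t ∈ Icc (0 : ℝ) 1, OnBoundary s t → v s t = u s t) ∧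
      ∀ s ∈ Icc (0 : ℝ) 1, ∀ t ∈ Icc (0 : ℝ) 1, dist (v s t) z < ε

theorem Refinable.of_dist_le {Z : Type*} [MetricSpace Z] {z z' : Z} {δ ε δ' ε' : ℝ}
    (h : Refinable z δ ε) (hδ : δ' + dist z z' ≤ δ) (hε : ε + dist z z' ≤ ε') :
    Refinable z' δ' ε' := by
  intro u hu hb η hη
  filter_upwards [h u hu (fun s hs t ht hst => by
    have := dist_triangle (u s t) z' z
    have := hb s hs t ht hst
    rw [dist_comm z z'] at hδ; linarith) η hη] with N ⟨v, h1, h2, h3, h4⟩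
  refine ⟨v, h1, h2, h3, fun s hs t ht => ?_⟩
  have := dist_triangle (v s t) z z'
  linarith [h4 s hs t ht]

/-- A Lebesgue number of a cover by balls around refinable centres works everywhere. The radius `min
(d z) ε / 2` keeps boundary values within `d y` of the chosen centre `y`, and moving from `y` to `z`
costs less than `ε / 2`, the half left over in the choice of `d`. -/
theorem exists_uniform_refinable {Z : Type*} [MetricSpace Z] {K : Set Z} (hK : IsCompact K)
    (h : ∀ z ∈ K, ∀ ε > 0, ∃ δ > 0, Refinable z δ ε) {ε : ℝ} (hε : 0 < ε) :
    ∃ δ > 0, ∀ z ∈ K, Refinable z δ ε := by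
  choose! d hd hR using fun z hz => h z hz (ε / 2) (half_pos hε)
  let c : K → Set Z := fun z => Metric.ball (z : Z) (min (d z) ε / 2)
  obtain ⟨δ, hδ, hc⟩ := lebesgue_number_lemma_of_metric hK (c := c)
    (fun _ => Metric.isOpen_ball) (fun z hz => mem_iUnion.2 ⟨⟨z, hz⟩,
      Metric.mem_ball_self (half_pos (lt_min (hd z hz) hε))⟩)
  refine ⟨δ, hδ, fun z hz => ?_⟩
  obtain ⟨⟨y, hy⟩, hyc⟩ := hc z hz
  have hzy : dist y z < min (d y) ε / 2 := by
    rw [dist_comm]; exact hyc (Metric.mem_ball_self hδ)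
  intro u hu hb η hη
  filter_upwards [hR y hy u hu (fun s hs t ht hst => by
    have := hyc (Metric.mem_ball.2 (hb s hs t ht hst))
    have h1 := min_le_left (d y) ε
    have h2 := lt_min (hd y hy) hε
    rw [Metric.mem_ball] at this
    simp only at this; linarith) η hη] with N ⟨v, h1, h2, h3, h4⟩
  refine ⟨v, h1, h2, h3, fun s hs t ht => ?_⟩
  have := dist_triangle (v s t) y z
  have := min_le_right (d y) ε
  linarith [h4 s hs t ht]

/-- Refining a subdivision in all cells simultaneously. -/
theorem exists_refinement {Z : Type*} [MetricSpace Z] {K : Set Z} {δ ε η₀ : ℝ} (hδε : δ ≤ ε)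
    (hK : ∀ z ∈ K, Refinable z δ ε) {M : ℕ} (hM : 0 < M) {v : ℝ → ℝ → Z}
    (hv : GridContinuous M v) (hosc : CellOscillationLE M η₀ v) (hη₀ : η₀ < δ)
    (hvK : ∀ s ∈ Icc (0 : ℝ) 1, ∀ t ∈ Icc (0 : ℝ) 1, v s t ∈ K) {η : ℝ} (hη : 0 < η) :
    ∃ (N : ℕ) (v' : ℝ → ℝ → Z), 0 < N ∧ GridContinuous N v' ∧ CellOscillationLE N η v' ∧
      (∀ s ∈ Icc (0 : ℝ) 1, ∀ t ∈ Icc (0 : ℝ) 1, OnBoundary s t → v' s t = v s t) ∧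
      ∀ s ∈ Icc (0 : ℝ) 1, ∀ t ∈ Icc (0 : ℝ) 1, dist (v s t) (v' s t) ≤ 2 * ε := by
  have h0 : (0 : ℝ) < M := by exact_mod_cast hM
  have hscale : ∀ i < M, ∀ s ∈ Icc (0 : ℝ) 1, ((i : ℝ) + s) / M ∈ unitCell M i := by
    intro i hi s hs
    rw [mem_unitCell_iff hM, mul_div_cancel₀ _ h0.ne']
    exact ⟨by linarith [hs.1], by linarith [hs.2]⟩
  have hscale' : ∀ i < M, ∀ s ∈ unitCell M i, (M : ℝ) * s - i ∈ Icc (0 : ℝ) 1 := by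
    intro i hi s hs
    rw [mem_unitCell_iff hM] at hs
    exact ⟨by linarith, by linarith⟩
  -- One `N` has to serve all cells; this is why `Refinable` asks for all large `N`. The map on the
  -- boundary of a cell is within `η₀ < δ` of its value at the lower left corner.
  have hw : ∀ᶠ N : ℕ in atTop, ∀ i < M, ∀ j < M, ∃ w : ℝ → ℝ → Z, GridContinuous N w ∧
      CellOscillationLE N η w ∧
      (∀ s ∈ Icc (0 : ℝ) 1, ∀ t ∈ Icc (0 : ℝ) 1, OnBoundary s t →
        w s t = v ((i + s) / M) ((j + t) / M)) ∧
      ∀ s ∈ Icc (0 : ℝ) 1, ∀ t ∈ Icc (0 : ℝ) 1, dist (w s t) (v (i / M) (j / M)) < ε := by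
    have hfin : {i : ℕ | i < M}.Finite := finite_lt_nat M
    refine (eventually_all_finite hfin).2 fun i hi => (eventually_all_finite hfin).2 fun j hj => ?_
    have hi' : i < M := hi
    have hj' : j < M := hj
    refine hK _ (hvK _ (div_mem_unitInterval hi'.le) _ (div_mem_unitInterval hj'.le))
      (fun s t => v ((i + s) / M) ((j + t) / M)) (fun k hk => ⟨?_, ?_⟩)
      (fun s hs t ht _ => lt_of_le_of_lt (hosc i hi j hj _ (hscale i hi s hs) _
        (left_mem_unitCell hM i) _ (hscale j hj t ht) _ (left_mem_unitCell hM j)) hη₀) η hη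
    · have := (hv (j + k) (by omega)).1
      have e : ((j : ℝ) + (k : ℝ) / (1 : ℕ)) / M = ((j + k : ℕ) : ℝ) / M := by simp
      simp only [e]
      exact this.comp (f := fun s : ℝ => (i + s) / M) (by fun_prop)
        (fun s hs => unitCell_subset hi (hscale i hi s hs))
    · have := (hv (i + k) (by omega)).2
      have e : ((i : ℝ) + (k : ℝ) / (1 : ℕ)) / M = ((i + k : ℕ) : ℝ) / M := by simp
      simp only [e]
      exact this.comp (f := fun s : ℝ => (j + s) / M) (by fun_prop)
        (fun s hs => unitCell_subset hj (hscale j hj s hs))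
  obtain ⟨N, hwN, hN⟩ := (hw.and (eventually_gt_atTop 0)).exists
  have h0N : (0 : ℝ) < N := by exact_mod_cast hN
  have : Nonempty Z := ⟨v 0 0⟩
  choose! w hwc hwo hwb hwd using hwN
  set v' : ℝ → ℝ → Z := fun s t =>
    w (cellIndex M s) (cellIndex M t) (M * s - cellIndex M s) (M * t - cellIndex M t) with hv'
  have hb : ∀ i < M, ∀ j < M, ∀ s ∈ unitCell M i, ∀ t ∈ unitCell M j,
      OnBoundary (M * s - i) (M * t - j) → w i j (M * s - i) (M * t - j) = v s t := by
    intro i hi j hj s hs t ht hst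
    rw [hwb i hi j hj _ (hscale' i hi s hs) _ (hscale' j hj t ht) hst, add_sub_cancel,
      add_sub_cancel, mul_div_cancel_left₀ _ h0.ne', mul_div_cancel_left₀ _ h0.ne']
  have hcell : ∀ i < M, ∀ j < M, ∀ s ∈ unitCell M i, ∀ t ∈ unitCell M j,
      v' s t = w i j (M * s - i) (M * t - j) := by
    intro i hi j hj s hs t ht
    have hs' := mem_unitCell_cellIndex hM (unitCell_subset hi hs)
    have ht' := mem_unitCell_cellIndex hM (unitCell_subset hj ht)
    -- A point of several cells lies on the boundary of each, where every `w` returns the value of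
    -- `v`; so the choice made by `cellIndex` does not matter.
    have key : OnBoundary (M * s - cellIndex M s) (M * t - cellIndex M t) →
        OnBoundary (M * s - i) (M * t - j) → v' s t = w i j (M * s - i) (M * t - j) := by
      intro h1 h2
      rw [hb i hi j hj s hs t ht h2]
      exact hb _ (cellIndex_lt hM s) _ (cellIndex_lt hM t) s hs' t ht' h1
    rcases cellIndex_eq_or hi hs with h | ⟨h, h'⟩
    · rcases cellIndex_eq_or hj ht with h2 | ⟨h2, h2'⟩
      · simp only [hv', h, h2]
      · exact key (.inr (.inr (.inl (by rw [h2, h2']; push_cast; ring))))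
          (.inr (.inr (.inr (by rw [h2']; ring))))
    · exact key (.inl (by rw [h, h']; push_cast; ring)) (.inr (.inl (by rw [h']; ring)))
  -- A line of the `M * N` grid, rescaled in a cell of the `M` grid containing it, is a line of the
  -- `N` grid.
  have hk : ∀ k ≤ M * N, ∃ j < M, ∃ k' ≤ N, (k : ℝ) / (M * N : ℕ) ∈ unitCell M j ∧
      M * ((k : ℝ) / (M * N : ℕ)) - j = k' / N := by
    intro k hk
    have hmem := mem_unitCell_cellIndex hM (div_mem_unitInterval hk)
    set j := cellIndex M ((k : ℝ) / (M * N : ℕ)) with hj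
    have e : M * ((k : ℝ) / (M * N : ℕ)) = k / N := by push_cast; field_simp
    have h2 := (mem_unitCell_iff hM).1 hmem
    rw [e, le_div_iff₀ h0N, div_le_iff₀ h0N] at h2
    have h3 : j * N ≤ k := by exact_mod_cast h2.1
    have h4 : k ≤ (j + 1) * N := by exact_mod_cast h2.2
    refine ⟨j, cellIndex_lt hM _, k - j * N, ?_, hmem, ?_⟩
    · rw [add_mul, one_mul] at h4; omega
    · rw [e, Nat.cast_sub h3]; push_cast; field_simp
  have hsub : ∀ a < M * N, ∃ i < M, ∃ a' < N, ∀ s ∈ unitCell (M * N) a,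
      s ∈ unitCell M i ∧ (M : ℝ) * s - i ∈ unitCell N a' := by
    intro a ha
    refine ⟨a / N, Nat.div_lt_of_lt_mul (by rwa [mul_comm] at ha), a % N, Nat.mod_lt _ hN,
      fun s hs => ?_⟩
    rw [mem_unitCell_iff (Nat.mul_pos hM hN)] at hs
    have e : (a : ℝ) = N * (a / N : ℕ) + (a % N : ℕ) := by exact_mod_cast (Nat.div_add_mod a N).symm
    have e2 : ((a % N : ℕ) : ℝ) + 1 ≤ N := by exact_mod_cast Nat.mod_lt _ hN
    have e3 : (0 : ℝ) ≤ ((a % N : ℕ) : ℝ) := by positivity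
    push_cast at hs
    rw [mem_unitCell_iff hM, mem_unitCell_iff hN]
    set x : ℝ := ((a / N : ℕ) : ℝ)
    refine ⟨⟨?_, ?_⟩, by nlinarith, by nlinarith⟩
    · refine le_of_mul_le_mul_left ?_ h0N; nlinarith
    · refine le_of_mul_le_mul_left ?_ h0N; nlinarith
  refine ⟨M * N, v', Nat.mul_pos hM hN, fun k hkMN => ?_, ?_, ?_, fun s hs t ht => ?_⟩
  · obtain ⟨j, hj, k', hk', hmem, he⟩ := hk k hkMN
    refine ⟨continuousOn_of_unitCell hM fun i hi => ?_, continuousOn_of_unitCell hM fun i hi => ?_⟩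
    · refine ContinuousOn.congr ?_ fun s hs => hcell i hi j hj s hs _ hmem
      rw [he]
      exact (hwc i hi j hj k' hk').1.comp (f := fun s : ℝ => M * s - i) (by fun_prop)
        (fun s hs => hscale' i hi s hs)
    · refine ContinuousOn.congr ?_ fun s hs => hcell j hj i hi _ hmem s hs
      rw [he]
      exact (hwc j hj i hi k' hk').2.comp (f := fun s : ℝ => M * s - i) (by fun_prop)
        (fun s hs => hscale' i hi s hs)
  · intro a ha b hb s hs s' hs' t ht t' ht'
    obtain ⟨i, hi, a', ha', hia⟩ := hsub a ha
    obtain ⟨j, hj, b', hb', hjb⟩ := hsub b hb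
    rw [hcell i hi j hj s (hia s hs).1 t (hjb t ht).1,
      hcell i hi j hj s' (hia s' hs').1 t' (hjb t' ht').1]
    exact hwo i hi j hj a' ha' b' hb' _ (hia s hs).2 _ (hia s' hs').2 _ (hjb t ht).2 _ (hjb t' ht').2
  · have hz : (0 : ℝ) ∈ unitCell M 0 := by simpa using left_mem_unitCell hM 0
    have ho : (1 : ℝ) ∈ unitCell M (M - 1) := by
      have := right_mem_unitCell hM (M - 1)
      rwa [Nat.sub_add_cancel hM, div_self h0.ne'] at this
    have e1 : (M : ℝ) * 1 - (M - 1 : ℕ) = 1 := by rw [Nat.cast_sub hM]; push_cast; ring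
    have e0 : (M : ℝ) * 0 - (0 : ℕ) = 0 := by simp
    have hM1 : M - 1 < M := by omega
    intro s hs t ht hst
    have hs' := mem_unitCell_cellIndex hM hs
    have ht' := mem_unitCell_cellIndex hM ht
    have hsl := cellIndex_lt hM s
    have htl := cellIndex_lt hM t
    rcases hst with rfl | rfl | rfl | rfl
    · rw [hcell 0 hM _ htl _ hz t ht']
      exact hb 0 hM _ htl _ hz t ht' (.inl e0)
    · rw [hcell _ hM1 _ htl _ ho t ht']
      exact hb _ hM1 _ htl _ ho t ht' (.inr (.inl e1))
    · rw [hcell _ hsl 0 hM s hs' _ hz]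
      exact hb _ hsl 0 hM s hs' _ hz (.inr (.inr (.inl e0)))
    · rw [hcell _ hsl _ hM1 s hs' _ ho]
      exact hb _ hsl _ hM1 s hs' _ ho (.inr (.inr (.inr e1)))
  · have hs' := mem_unitCell_cellIndex hM hs
    have ht' := mem_unitCell_cellIndex hM ht
    have hsl := cellIndex_lt hM s
    have htl := cellIndex_lt hM t
    rw [hcell _ hsl _ htl s hs' t ht']
    -- Both maps are compared with the value at the corner of the cell: the new one is within `ε`,
    -- the old one within `η₀ < δ ≤ ε`.
    have h1 := hwd _ hsl _ htl _ (hscale' _ hsl s hs') _ (hscale' _ htl t ht')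
    have h2 := hosc _ hsl _ htl s hs' _ (left_mem_unitCell hM _) t ht' _ (left_mem_unitCell hM _)
    have := dist_triangle_right (v s t) (w (cellIndex M s) (cellIndex M t) (M * s - cellIndex M s)
      (M * t - cellIndex M t)) (v (cellIndex M s / M) (cellIndex M t / M))
    linarith

/-- Close points of the unit interval lie in cells with a common point. -/
theorem exists_common_point {M : ℕ} (hM : 0 < M) {s s' : ℝ} (hs : s ∈ Icc (0 : ℝ) 1)
    (hs' : s' ∈ Icc (0 : ℝ) 1) (h : |s - s'| ≤ 1 / M) :
    ∃ i < M, ∃ j < M, ∃ c, s ∈ unitCell M i ∧ c ∈ unitCell M i ∧ c ∈ unitCell M j ∧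
      s' ∈ unitCell M j := by
  wlog hle : s ≤ s' generalizing s s'
  · obtain ⟨i, hi, j, hj, c, h1, h2, h3, h4⟩ := this hs' hs (by rwa [abs_sub_comm]) (by linarith)
    exact ⟨j, hj, i, hi, c, h4, h3, h2, h1⟩
  have h0 : (0 : ℝ) < M := by exact_mod_cast hM
  have hi := cellIndex_lt hM s
  have hsi := mem_unitCell_cellIndex hM hs
  by_cases hm : s' ∈ unitCell M (cellIndex M s)
  · exact ⟨_, hi, _, hi, s', hsi, hm, hm, hm⟩
  have h1 := (mem_unitCell_iff hM).1 hsi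
  rw [mem_unitCell_iff hM] at hm
  have h2 : (cellIndex M s : ℝ) + 1 < M * s' := by
    by_contra hcon
    exact hm ⟨h1.1.trans (by gcongr), not_lt.1 hcon⟩
  have h3 : M * s' ≤ M * s + 1 := by
    rw [abs_sub_comm, abs_of_nonneg (by linarith), le_div_iff₀ h0] at h
    linarith
  have h4 : cellIndex M s + 1 < M := by
    have : (cellIndex M s : ℝ) + 1 < M := h2.trans_le (by nlinarith [hs'.2])
    exact_mod_cast this
  refine ⟨_, hi, _, h4, _, hsi, right_mem_unitCell hM _, left_mem_unitCell hM _, ?_⟩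
  rw [mem_unitCell_iff hM]; push_cast
  exact ⟨h2.le, by linarith⟩

/-- Points at most one mesh width apart lie in cells with a common point, and passing through it
costs the oscillation twice. This replaces continuity for maps that jump inside cells. -/
theorem CellOscillationLE.dist_le {Z : Type*} [MetricSpace Z] {M : ℕ} {η : ℝ} {v : ℝ → ℝ → Z}
    (h : CellOscillationLE M η v) (hM : 0 < M) {s s' t t' : ℝ} (hs : s ∈ Icc (0 : ℝ) 1)
    (hs' : s' ∈ Icc (0 : ℝ) 1) (ht : t ∈ Icc (0 : ℝ) 1) (ht' : t' ∈ Icc (0 : ℝ) 1)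
    (h1 : |s - s'| ≤ 1 / M) (h2 : |t - t'| ≤ 1 / M) : dist (v s t) (v s' t') ≤ 2 * η := by
  obtain ⟨i, hi, j, hj, c, a1, a2, a3, a4⟩ := exists_common_point hM hs hs' h1
  obtain ⟨k, hk, l, hl, d, b1, b2, b3, b4⟩ := exists_common_point hM ht ht' h2
  have := dist_triangle (v s t) (v c d) (v s' t')
  linarith [h i hi k hk s a1 c a2 t b1 d b2, h j hj l hl c a3 s' a4 d b3 t' b4]

/-- If refinement is uniformly possible near `y`, small maps of the boundary of the square near `y`
extend to small maps of the square. -/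
theorem exists_filling_of_refinable {Z : Type*} [MetricSpace Z] {K : Set Z} (hKc : IsComplete K)
    (hK : ∀ ε > 0, ∃ δ > 0, ∀ z ∈ K, Refinable z δ ε) {y : Z} {R : ℝ} (hR : 0 < R)
    (hyK : Metric.closedBall y R ⊆ K) :
    ∃ δ > 0, ∀ u : ℝ → ℝ → Z, GridContinuous 1 u →
      (∀ s ∈ Icc (0 : ℝ) 1, ∀ t ∈ Icc (0 : ℝ) 1, OnBoundary s t → dist (u s t) y < δ) →
      ∃ V : ℝ → ℝ → Z, ContinuousOn (Function.uncurry V) (Icc 0 1 ×ˢ Icc 0 1) ∧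
        (∀ s ∈ Icc (0 : ℝ) 1, ∀ t ∈ Icc (0 : ℝ) 1, OnBoundary s t → V s t = u s t) ∧
        ∀ s ∈ Icc (0 : ℝ) 1, ∀ t ∈ Icc (0 : ℝ) 1, dist (V s t) y ≤ R := by
  -- The refinement at stage `n` moves points by at most twice this, `R / 4 / 2 ^ n`. The sum is at
  -- most `R / 2`, which with the initial `R / 8` stays below `R`.
  have hε : ∀ n : ℕ, 0 < R / 8 / 2 ^ n := fun n => by positivity
  choose d' hd' hdR using fun n => hK _ (hε n)
  set d : ℕ → ℝ := fun n => min (d' n) (R / 8 / 2 ^ n) with hd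
  have hd0 : ∀ n, 0 < d n := fun n => lt_min (hd' n) (hε n)
  have hdε : ∀ n, d n ≤ R / 8 / 2 ^ n := fun n => min_le_right _ _
  have hdR' : ∀ n, ∀ z ∈ K, Refinable z (d n) (R / 8 / 2 ^ n) := by
    intro n z hz u hu hb
    exact hdR n z hz u hu fun s hs t ht hst => (hb s hs t ht hst).trans_le (min_le_left _ _)
  refine ⟨d 0 / 4, by linarith [hd0 0], fun u hu hub => ?_⟩
  -- The invariant of the iteration. Oscillation `d n / 2` is strictly below the scale `d n` at
  -- which the next refinement is available.
  let P : ℕ → ℕ × (ℝ → ℝ → Z) → Prop := fun n x => 0 < x.1 ∧ GridContinuous x.1 x.2 ∧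
    CellOscillationLE x.1 (d n / 2) x.2 ∧
    (∀ s ∈ Icc (0 : ℝ) 1, ∀ t ∈ Icc (0 : ℝ) 1, OnBoundary s t → x.2 s t = u s t) ∧
    ∀ s ∈ Icc (0 : ℝ) 1, ∀ t ∈ Icc (0 : ℝ) 1,
      dist (x.2 s t) y ≤ R / 8 + R / 2 * (1 - 1 / 2 ^ n)
  have hbound : ∀ n : ℕ, R / 8 + R / 2 * (1 - 1 / 2 ^ n) ≤ R := by
    intro n
    have : (0 : ℝ) < 1 / 2 ^ n := by positivity
    nlinarith
  have hstep : ∀ n x, ∃ x', P n x → P (n + 1) x' ∧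
      ∀ s ∈ Icc (0 : ℝ) 1, ∀ t ∈ Icc (0 : ℝ) 1, dist (x.2 s t) (x'.2 s t) ≤ R / 2 / 2 / 2 ^ n := by
    intro n x
    by_cases hx : P n x
    swap
    · exact ⟨x, fun h => absurd h hx⟩
    obtain ⟨h1, h2, h3, h4, h5⟩ := hx
    obtain ⟨N, v', g1, g2, g3, g4, g5⟩ := exists_refinement (hdε n) (hdR' n) h1 h2 h3
      (half_lt_self (hd0 n)) (fun s hs t ht => hyK ((h5 s hs t ht).trans (hbound n)))
      (half_pos (hd0 (n + 1)))
    have g6 : ∀ s ∈ Icc (0 : ℝ) 1, ∀ t ∈ Icc (0 : ℝ) 1,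
        dist (x.2 s t) (v' s t) ≤ R / 2 / 2 / 2 ^ n := fun s hs t ht =>
      (g5 s hs t ht).trans (le_of_eq (by ring))
    refine ⟨(N, v'), fun _ => ⟨⟨g1, g2, g3, fun s hs t ht hst => ?_, fun s hs t ht => ?_⟩, g6⟩⟩
    · rw [← h4 s hs t ht hst]; exact g4 s hs t ht hst
    · have e1 := dist_triangle_left (v' s t) y (x.2 s t)
      have e2 := g6 s hs t ht
      have e3 := h5 s hs t ht
      have e4 : R / 8 + R / 2 * (1 - 1 / 2 ^ (n + 1)) =
          R / 8 + R / 2 * (1 - 1 / 2 ^ n) + R / 2 / 2 / 2 ^ n := by rw [pow_succ]; field_simp; ring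
      simp only [e4]; linarith
  choose next hnext using hstep
  classical
  -- The start may jump inside the square, since the lines of the `1 × 1` grid are just its sides.
  -- Its oscillation is at most `d 0 / 4 + d 0 / 4`.
  let v₀ : ℝ → ℝ → Z := fun s t => if OnBoundary s t then u s t else y
  have hv₀ : ∀ s ∈ Icc (0 : ℝ) 1, ∀ t ∈ Icc (0 : ℝ) 1, dist (v₀ s t) y ≤ d 0 / 4 := by
    intro s hs t ht
    by_cases h : OnBoundary s t
    · simp only [v₀, if_pos h]; exact (hub s hs t ht h).le
    · simp only [v₀, if_neg h, dist_self]; linarith [hd0 0]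
  have hP₀ : P 0 (1, v₀) := by
    refine ⟨one_pos, fun k hk => ?_, ?_, fun s _ t _ hst => if_pos hst, fun s hs t ht => ?_⟩
    · have hk' : (k : ℝ) / (1 : ℕ) = 0 ∨ (k : ℝ) / (1 : ℕ) = 1 := by
        interval_cases k <;> simp
      refine ⟨(hu k hk).1.congr fun s _ => if_pos ?_, (hu k hk).2.congr fun s _ => if_pos ?_⟩
      · exact hk'.elim (fun h => .inr (.inr (.inl h))) (fun h => .inr (.inr (.inr h)))
      · exact hk'.elim (fun h => .inl h) (fun h => .inr (.inl h))
    · intro i hi j hj s hs s' hs' t ht t' ht'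
      have := dist_triangle_right (v₀ s t) (v₀ s' t') y
      linarith [hv₀ s (unitCell_subset hi hs) t (unitCell_subset hj ht),
        hv₀ s' (unitCell_subset hi hs') t' (unitCell_subset hj ht')]
    · have := hdε 0
      have := hv₀ s hs t ht
      simp only [pow_zero, div_one, sub_self, mul_zero, add_zero] at *
      linarith
  let x : ℕ → ℕ × (ℝ → ℝ → Z) := fun n => Nat.rec (1, v₀) next n
  have hxP : ∀ n, P n (x n) := by
    intro n
    induction n with
    | zero => exact hP₀
    | succ n ih => exact (hnext n (x n) ih).1
  have hxd : ∀ n, ∀ s ∈ Icc (0 : ℝ) 1, ∀ t ∈ Icc (0 : ℝ) 1,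
      dist ((x n).2 s t) ((x (n + 1)).2 s t) ≤ R / 2 / 2 / 2 ^ n := fun n =>
    (hnext n (x n) (hxP n)).2
  have hlim : ∀ s t, ∃ a, s ∈ Icc (0 : ℝ) 1 → t ∈ Icc (0 : ℝ) 1 →
      Tendsto (fun n => (x n).2 s t) atTop (𝓝 a) := by
    intro s t
    by_cases h : s ∈ Icc (0 : ℝ) 1 ∧ t ∈ Icc (0 : ℝ) 1
    · obtain ⟨a, -, ha⟩ := cauchySeq_tendsto_of_isComplete hKc
        (fun n => hyK (((hxP n).2.2.2.2 s h.1 t h.2).trans (hbound n)))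
        (cauchySeq_of_le_geometric_two fun n => hxd n s h.1 t h.2)
      exact ⟨a, fun _ _ => ha⟩
    · exact ⟨y, fun h1 h2 => absurd ⟨h1, h2⟩ h⟩
  choose V hV using hlim
  have hVd : ∀ n, ∀ s ∈ Icc (0 : ℝ) 1, ∀ t ∈ Icc (0 : ℝ) 1,
      dist ((x n).2 s t) (V s t) ≤ R / 2 / 2 ^ n := fun n s hs t ht =>
    dist_le_of_le_geometric_two_of_tendsto (fun n => hxd n s hs t ht) (hV s t hs ht) n
  refine ⟨V, ?_, fun s hs t ht hst => ?_, fun s hs t ht => ?_⟩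
  · rw [Metric.continuousOn_iff]
    rintro ⟨s, t⟩ ⟨hs, ht⟩ θ hθ
    -- At distance less than the mesh of stage `n`, the limit varies by at most `d n` plus two
    -- errors `R / 2 / 2 ^ n`, in all at most `(9 / 8) R / 2 ^ n`, which is less than `θ`.
    obtain ⟨n, hn⟩ := exists_pow_lt_of_lt_one (div_pos hθ (mul_pos two_pos hR)) (one_half_lt_one)
    obtain ⟨h1, -, h3, -, -⟩ := hxP n
    refine ⟨1 / (x n).1, by positivity, ?_⟩
    rintro ⟨s', t'⟩ ⟨hs', ht'⟩ hdist
    rw [Prod.dist_eq, max_lt_iff, Real.dist_eq, Real.dist_eq] at hdist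
    have e1 := h3.dist_le h1 hs' hs ht' ht hdist.1.le hdist.2.le
    have e2 := hVd n s hs t ht
    have e3 := hVd n s' hs' t' ht'
    have e4 := hdε n
    have e5 := dist_triangle4 (V s' t') ((x n).2 s' t') ((x n).2 s t) (V s t)
    rw [dist_comm (V s' t') ((x n).2 s' t')] at e5
    have e6 : R / 8 / 2 ^ n = R / 8 * (1 / 2) ^ n := by rw [one_div, inv_pow]; rfl
    have e7 : R / 2 / 2 ^ n = R / 2 * (1 / 2) ^ n := by rw [one_div, inv_pow]; rfl
    rw [lt_div_iff₀ (by positivity)] at hn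
    have e8 : 0 < R * (1 / 2 : ℝ) ^ n := by positivity
    simp only [Function.uncurry] at *
    rw [e6] at e4; rw [e7] at e2 e3
    nlinarith
  · refine tendsto_nhds_unique (hV s t hs ht) ?_
    refine tendsto_const_nhds.congr fun n => ?_
    exact ((hxP n).2.2.2.1 s hs t ht hst).symm
  · refine le_of_tendsto ((hV s t hs ht).dist tendsto_const_nhds) (.of_forall fun n => ?_)
    exact ((hxP n).2.2.2.2 s hs t ht).trans (hbound n)

/-! ### Almost geodesics in length spaces and geodesics from midpoints -/

/-- In a length space, points are joined by curves of almost minimal length; such a curve stays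
close to its initial point and passes through an almost midpoint. -/
theorem IsLengthSpace.exists_path {X : Type*} [MetricSpace X] (h : IsLengthSpace X) (x y : X)
    {r : ℝ} (hr : dist x y < r) : ∃ γ : Path x y, (∀ s, dist (γ s) x < r) ∧
      ∃ s, dist (γ s) x = dist x y / 2 ∧ dist (γ s) y < r - dist x y / 2 := by
  have hlt : ⨅ γ : Path x y, eVariationOn (fun s : I => γ s) univ < ENNReal.ofReal r := by
    rw [h x y, edist_dist]
    exact (ENNReal.ofReal_lt_ofReal_iff (dist_nonneg.trans_lt hr)).2 hr
  obtain ⟨γ, hγ⟩ := iInf_lt_iff.1 hlt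
  have hsum : ∀ s, dist (γ s) x + dist (γ s) y < r := by
    intro s
    have e1 := eVariationOn.Icc_add_Icc (fun s : I => γ s) (s := univ) (a := 0) (b := s) (c := 1)
      s.2.1 s.2.2 (mem_univ _)
    have e2 := eVariationOn.edist_le (fun s : I => γ s) (s := univ ∩ Icc 0 s) (x := s) (y := 0)
      ⟨mem_univ _, s.2.1, le_rfl⟩ ⟨mem_univ _, le_rfl, s.2.1⟩
    have e3 := eVariationOn.edist_le (fun s : I => γ s) (s := univ ∩ Icc s 1) (x := s) (y := 1)
      ⟨mem_univ _, le_rfl, s.2.2⟩ ⟨mem_univ _, s.2.2, le_rfl⟩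
    have e4 := (add_le_add e2 e3).trans_lt ((e1.le.trans (eVariationOn.mono _ (subset_univ _))).trans_lt hγ)
    simp only [γ.source, γ.target] at e4
    rw [edist_dist, edist_dist, ← ENNReal.ofReal_add dist_nonneg dist_nonneg] at e4
    exact (ENNReal.ofReal_lt_ofReal_iff (dist_nonneg.trans_lt hr)).1 e4
  refine ⟨γ, fun s => lt_of_le_of_lt (by linarith [dist_nonneg (x := γ s) (y := y)]) (hsum s), ?_⟩
  have hc : Continuous fun s => dist (γ s) x := by fun_prop
  obtain ⟨s, hs⟩ := mem_range_of_exists_le_of_exists_ge hc (c := dist x y / 2)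
    ⟨0, by simp [div_nonneg]⟩ ⟨1, by rw [γ.target, dist_comm y x]; linarith [dist_nonneg (x := x) (y := y)]⟩
  exact ⟨s, hs, by have := hsum s; simp only at hs; linarith⟩

/-- Repeated bisection of the segment from `a` to `b`, where `m` chooses midpoints. -/
noncomputable def bisection {Z : Type*} (m : Z → Z → Z) : ℕ → Z → Z → ℝ → Z
  | 0, a, _, _ => a
  | n + 1, a, b, s =>
    if s < 1 / 2 then bisection m n a (m a b) (2 * s) else bisection m n (m a b) b (2 * s - 1)

/-- Midpoints and completeness yield geodesics. The relation `P` singles out the pairs of points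
between which midpoints are available. -/
theorem exists_geodesic {Z : Type*} [MetricSpace Z] {S : Set Z} (hS : IsComplete S)
    {P : Z → Z → Prop} (hPS : ∀ a b, P a b → a ∈ S)
    (hmid : ∀ a b, P a b → ∃ m, P a m ∧ P m b ∧ dist a m = dist a b / 2 ∧
      dist m b = dist a b / 2) {a b : Z} (hab : P a b) :
    ∃ γ : Path a b, ∀ s, dist (γ s) a ≤ dist a b := by
  have : Nonempty Z := ⟨a⟩
  choose! m hm1 hm2 hm3 hm4 using hmid
  set c := bisection m with hc
  have c0 : ∀ a b s, c 0 a b s = a := fun _ _ _ => rfl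
  have cl : ∀ n a b s, s < 1 / 2 → c (n + 1) a b s = c n a (m a b) (2 * s) :=
    fun n a b s h => by rw [hc, bisection, if_pos h]
  have cr : ∀ n a b s, ¬ s < 1 / 2 → c (n + 1) a b s = c n (m a b) b (2 * s - 1) :=
    fun n a b s h => by rw [hc, bisection, if_neg h]
  have cS : ∀ n a b, P a b → ∀ s, c n a b s ∈ S := by
    intro n
    induction n with
    | zero => intro a b h s; exact hPS a b h
    | succ n ih =>
      intro a b h s
      by_cases hs : s < 1 / 2
      · rw [cl _ _ _ _ hs]; exact ih _ _ (hm1 a b h) _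
      · rw [cr _ _ _ _ hs]; exact ih _ _ (hm2 a b h) _
  have cstep : ∀ n a b, P a b → ∀ s, dist (c n a b s) (c (n + 1) a b s) ≤
      dist a b / 2 / 2 ^ n := by
    intro n
    induction n with
    | zero =>
      intro a b h s
      by_cases hs : s < 1 / 2
      · rw [cl _ _ _ _ hs, c0, c0, dist_self]; positivity
      · rw [cr _ _ _ _ hs, c0, c0, hm3 a b h]; simp
    | succ n ih =>
      intro a b h s
      by_cases hs : s < 1 / 2
      · rw [cl _ _ _ _ hs, cl _ _ _ _ hs]
        refine (ih _ _ (hm1 a b h) _).trans (le_of_eq ?_)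
        rw [hm3 a b h, pow_succ]; field_simp
      · rw [cr _ _ _ _ hs, cr _ _ _ _ hs]
        refine (ih _ _ (hm2 a b h) _).trans (le_of_eq ?_)
        rw [hm4 a b h, pow_succ]; field_simp
  have hpow : ∀ n : ℕ, (1 : ℝ) / 2 ^ n = 2 * (1 / 2 ^ (n + 1)) := fun n => by
    rw [pow_succ]; field_simp
  -- The approximations are step functions, whence the errors `1 / 2 ^ n`, which vanish in the
  -- limit. The bounds `cA` and `cB` are needed for `cL` when the two parameters lie in different
  -- halves: one then passes through the midpoint.
  have cA : ∀ n a b, P a b → ∀ s, 0 ≤ s → dist (c n a b s) a ≤ dist a b * (s + 1 / 2 ^ n) := by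
    intro n
    induction n with
    | zero => intro a b h s hs; rw [c0, dist_self]; positivity
    | succ n ih =>
      intro a b h s hs0
      by_cases hs : s < 1 / 2
      · rw [cl _ _ _ _ hs]
        refine (ih _ _ (hm1 a b h) _ (by linarith)).trans (le_of_eq ?_)
        rw [hm3 a b h, hpow n]; ring
      · rw [cr _ _ _ _ hs]
        have h1 := ih _ _ (hm2 a b h) (2 * s - 1) (by linarith)
        have h2 := dist_triangle (c n (m a b) b (2 * s - 1)) (m a b) a
        rw [dist_comm (m a b) a, hm3 a b h] at h2
        rw [hm4 a b h, hpow n] at h1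
        refine h2.trans ((add_le_add_left h1 _).trans (le_of_eq ?_)); ring
  have cB : ∀ n a b, P a b → ∀ s, s ≤ 1 →
      dist (c n a b s) b ≤ dist a b * (1 - s + 1 / 2 ^ n) := by
    intro n
    induction n with
    | zero =>
      intro a b h s hs; rw [c0]
      have : 0 ≤ dist a b * (1 - s) := mul_nonneg dist_nonneg (by linarith)
      simp; linarith
    | succ n ih =>
      intro a b h s hs1
      by_cases hs : s < 1 / 2
      · rw [cl _ _ _ _ hs]
        have h1 := ih _ _ (hm1 a b h) (2 * s) (by linarith)
        have h2 := dist_triangle (c n a (m a b) (2 * s)) (m a b) b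
        rw [hm4 a b h] at h2
        rw [hm3 a b h, hpow n] at h1
        refine h2.trans ((add_le_add_left h1 _).trans (le_of_eq ?_)); ring
      · rw [cr _ _ _ _ hs]
        refine (ih _ _ (hm2 a b h) _ (by linarith)).trans (le_of_eq ?_)
        rw [hm4 a b h, hpow n]; ring
  have cL : ∀ n a b, P a b → ∀ s t, 0 ≤ s → s ≤ t → t ≤ 1 →
      dist (c n a b s) (c n a b t) ≤ dist a b * (t - s + 2 * (1 / 2 ^ n)) := by
    intro n
    induction n with
    | zero =>
      intro a b h s t _ hst _
      rw [c0, c0, dist_self]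
      exact mul_nonneg dist_nonneg (by norm_num; linarith)
    | succ n ih =>
      intro a b h s t hs0 hst ht1
      by_cases ht : t < 1 / 2
      · rw [cl _ _ _ _ ht, cl _ _ _ _ (hst.trans_lt ht)]
        refine (ih _ _ (hm1 a b h) _ _ (by linarith) (by linarith) (by linarith)).trans
          (le_of_eq ?_)
        rw [hm3 a b h, hpow n]; ring
      by_cases hs : s < 1 / 2
      · rw [cl _ _ _ _ hs, cr _ _ _ _ ht]
        have h1 := cB n _ _ (hm1 a b h) (2 * s) (by linarith)
        have h2 := cA n _ _ (hm2 a b h) (2 * t - 1) (by linarith)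
        rw [hm3 a b h, hpow n] at h1
        rw [hm4 a b h, hpow n] at h2
        refine (dist_triangle_right _ _ (m a b)).trans ((add_le_add h1 h2).trans (le_of_eq ?_))
        ring
      · rw [cr _ _ _ _ hs, cr _ _ _ _ ht]
        refine (ih _ _ (hm2 a b h) _ _ (by linarith) (by linarith) (by linarith)).trans
          (le_of_eq ?_)
        rw [hm4 a b h, hpow n]; ring
  have hlim : ∀ s, ∃ y, Tendsto (fun n => c n a b s) atTop (𝓝 y) := by
    intro s
    obtain ⟨y, -, hy⟩ := cauchySeq_tendsto_of_isComplete hS (fun n => cS n a b hab s)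
      (cauchySeq_of_le_geometric_two (C := dist a b) fun n => cstep n a b hab s)
    exact ⟨y, hy⟩
  choose g hg using hlim
  have h0 : Tendsto (fun n : ℕ => (1 : ℝ) / 2 ^ n) atTop (𝓝 0) := by
    simp only [one_div]
    exact tendsto_inv_atTop_zero.comp (tendsto_pow_atTop_atTop_of_one_lt (one_lt_two (α := ℝ)))
  have gA : ∀ s, 0 ≤ s → dist (g s) a ≤ dist a b * s := fun s hs => by
    refine le_of_tendsto_of_tendsto' ((hg s).dist tendsto_const_nhds) ?_ fun n => cA n a b hab s hs
    simpa using (tendsto_const_nhds (x := dist a b)).mul ((tendsto_const_nhds (x := s)).add h0)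
  have gB : ∀ s, s ≤ 1 → dist (g s) b ≤ dist a b * (1 - s) := fun s hs => by
    refine le_of_tendsto_of_tendsto' ((hg s).dist tendsto_const_nhds) ?_ fun n => cB n a b hab s hs
    simpa using (tendsto_const_nhds (x := dist a b)).mul ((tendsto_const_nhds (x := 1 - s)).add h0)
  have gL : ∀ s t, 0 ≤ s → s ≤ t → t ≤ 1 → dist (g s) (g t) ≤ dist a b * (t - s) :=
    fun s t hs hst ht => by
      refine le_of_tendsto_of_tendsto' ((hg s).dist (hg t)) ?_ fun n => cL n a b hab s t hs hst ht
      simpa using (tendsto_const_nhds (x := dist a b)).mul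
        ((tendsto_const_nhds (x := t - s)).add (h0.const_mul 2))
  have hcont : Continuous fun s : I => g s := by
    refine (LipschitzWith.of_dist_le_mul (K := nndist a b) fun s t => ?_).continuous
    rw [coe_nndist, Subtype.dist_eq, Real.dist_eq]
    rcases le_total (s : ℝ) t with h | h
    · rw [abs_sub_comm, abs_of_nonneg (by linarith)]
      exact gL s t s.2.1 h t.2.2
    · rw [dist_comm, abs_of_nonneg (by linarith)]
      exact gL t s t.2.1 h s.2.2
  refine ⟨⟨⟨fun s => g s, hcont⟩, ?_, ?_⟩, fun s => ?_⟩
  · have := gA 0 le_rfl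
    rw [mul_zero] at this
    exact dist_le_zero.1 this
  · have := gB 1 le_rfl
    rw [sub_self, mul_zero] at this
    exact dist_le_zero.1 this
  · exact (gA s s.2.1).trans (mul_le_of_le_one_right dist_nonneg s.2.2)

/-! ### Compactness, midpoints and geodesics in the limit ball -/

section Limit

variable {X : ℕ → Type*} {Y : Type*} [∀ i, MetricSpace (X i)] [MetricSpace Y]
  {p : ∀ i, X i} {q : Y} {f : ∀ i, X i → Y}

/-- Closed balls of radius smaller than that of the convergent balls are compact. -/
theorem GHConvergesOnBall.isCompact_closedBall
    (hconv : GHConvergesOnBall p q 2 f) (hcompact : ∀ i, IsCompact (closure (Metric.ball (p i) 2)))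
    (hcomplete : IsComplete (closure (Metric.ball q 2))) {R : ℝ} (hR : R < 2) :
    IsCompact (Metric.closedBall q R) := by
  rw [isCompact_iff_totallyBounded_isComplete]
  constructor
  · rw [Metric.totallyBounded_iff]
    intro ε hε
    set η := min (ε / 5) ((2 - R) / 2) with hη
    have hη0 : 0 < η := lt_min (by positivity) (by linarith)
    have h1 : η ≤ ε / 5 := min_le_left _ _
    have h2 : η ≤ (2 - R) / 2 := min_le_right _ _
    -- A single good approximation suffices: the image of an `η`-net of the ball in `X i` is a
    -- `3η`-net of the closed ball.
    obtain ⟨i, hi⟩ := (hconv η hη0).exists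
    obtain ⟨t, hts, htf, hcov⟩ := totallyBounded_iff_subset.1
      ((hcompact i).totallyBounded.subset subset_closure) _ (Metric.dist_mem_uniformity hη0)
    refine ⟨f i '' t, htf.image _, fun y hy => ?_⟩
    rw [Metric.mem_closedBall] at hy
    obtain ⟨x, hx, hxy⟩ := hi.almost_onto y (by rw [Metric.mem_ball]; linarith)
    obtain ⟨x', hx't, hxx'⟩ := mem_iUnion₂.1 (hcov hx)
    have hxx' : dist x x' < η := hxx'
    have hd := abs_le.1 (hi.distortion x hx x' (hts hx't))
    refine mem_iUnion₂.2 ⟨f i x', mem_image_of_mem _ hx't, ?_⟩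
    have := dist_triangle_left y (f i x') (f i x)
    rw [Metric.mem_ball]; linarith
  · intro l hl hls
    obtain ⟨x, -, hx⟩ := hcomplete l hl (hls.trans (principal_mono.2
      ((Metric.closedBall_subset_ball hR).trans subset_closure)))
    have := hl.1
    exact ⟨x, Metric.isClosed_closedBall.mem_of_tendsto (f := id) (b := l) hx
      (le_principal_iff.1 hls), hx⟩

/-- Midpoints exist in the limit of length spaces, as far as the convergent balls reach. -/
theorem GHConvergesOnBall.exists_midpoint
    (hconv : GHConvergesOnBall p q 2 f) (hlength : ∀ i, IsLengthSpace (X i))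
    (hcompact : ∀ R < 2, IsCompact (Metric.closedBall q R)) {a b : Y}
    (hab : dist a q + dist b q + dist a b < 4) :
    ∃ m, dist a m = dist a b / 2 ∧ dist m b = dist a b / 2 := by
  set S := dist a q + dist b q + dist a b with hS
  -- A midpoint is at distance at most `S / 2 < 2` from `q`, by averaging the bounds through `a` and
  -- through `b`. The radius `R` lies strictly between, leaving room for the errors.
  set R := (S / 2 + 2) / 2 with hR
  have happ : ∀ ε > 0, ∃ m ∈ Metric.closedBall q R,
      max (dist a m) (dist m b) ≤ dist a b / 2 + ε := by
    intro ε hε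
    obtain ⟨η, hη, h1, h2⟩ : ∃ η > 0, η ≤ ε / 10 ∧ η ≤ (2 - S / 2) / 20 :=
      ⟨min (ε / 10) ((2 - S / 2) / 20), lt_min (by positivity) (by linarith), min_le_left _ _,
        min_le_right _ _⟩
    obtain ⟨i, hi⟩ := (hconv η hη).exists
    have hbase := hi.base
    have hp : p i ∈ Metric.ball (p i) 2 := by simp
    have haq := dist_triangle a b q
    have hbq := dist_triangle_left b q a
    obtain ⟨x, hx, hxa⟩ := hi.almost_onto a (by rw [Metric.mem_ball]; linarith)
    obtain ⟨y, hy, hyb⟩ := hi.almost_onto b (by rw [Metric.mem_ball]; linarith)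
    obtain ⟨γ, -, s, hs1, hs2⟩ := (hlength i).exists_path x y (r := dist x y + η) (by linarith)
    have dxy := abs_le.1 (hi.distortion x hx y hy)
    have dxp := abs_le.1 (hi.distortion x hx (p i) hp)
    have dyp := abs_le.1 (hi.distortion y hy (p i) hp)
    have t1 := dist_triangle4 (f i x) a b (f i y)
    have t2 := dist_triangle4 (f i x) a q (f i (p i))
    have t3 := dist_triangle4 (f i y) b q (f i (p i))
    rw [dist_comm b (f i y)] at t1
    rw [dist_comm q] at t2 t3
    have t4 := dist_triangle (γ s) x (p i)
    have t5 := dist_triangle (γ s) y (p i)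
    have hγ : γ s ∈ Metric.ball (p i) 2 := by rw [Metric.mem_ball]; linarith
    have dγx := abs_le.1 (hi.distortion _ hγ x hx)
    have dγy := abs_le.1 (hi.distortion _ hγ y hy)
    have dγp := abs_le.1 (hi.distortion _ hγ (p i) hp)
    refine ⟨f i (γ s), ?_, max_le ?_ ?_⟩
    · have := dist_triangle (f i (γ s)) (f i (p i)) q
      rw [Metric.mem_closedBall]; linarith
    · have := dist_triangle_left a (f i (γ s)) (f i x)
      rw [dist_comm (f i x) (f i (γ s))] at this
      linarith
    · have := dist_triangle (f i (γ s)) (f i y) b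
      linarith
  obtain ⟨m₁, hm₁, -⟩ := happ 1 one_pos
  obtain ⟨m, -, hm⟩ := (hcompact R (by linarith)).exists_isMinOn ⟨m₁, hm₁⟩
    (f := fun m => max (dist a m) (dist m b)) (by fun_prop)
  have hle : max (dist a m) (dist m b) ≤ dist a b / 2 := by
    refine le_of_forall_pos_le_add fun ε hε => ?_
    obtain ⟨m', hm', h⟩ := happ ε hε
    exact (hm hm').trans h
  have h1 := (le_max_left _ _).trans hle
  have h2 := (le_max_right _ _).trans hle
  have h3 := dist_triangle a m b
  exact ⟨m, by linarith, by linarith⟩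

/-- Geodesics exist in the limit of length spaces, as far as the convergent balls reach. -/
theorem GHConvergesOnBall.exists_geodesic
    (hconv : GHConvergesOnBall p q 2 f) (hlength : ∀ i, IsLengthSpace (X i))
    (hcompact : ∀ R < 2, IsCompact (Metric.closedBall q R))
    (hcomplete : IsComplete (closure (Metric.ball q 2))) {a b : Y}
    (hab : dist a q + dist b q + dist a b < 4) :
    ∃ γ : Path a b, ∀ s, dist (γ s) a ≤ dist a b := by
  -- The perimeter of the triangle `q, a, b` does not grow when `a` or `b` is replaced by a
  -- midpoint, so the condition passes to both halves.
  refine RicciLimit.exists_geodesic hcomplete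
    (P := fun a b => dist a q + dist b q + dist a b < 4) (fun a b h => ?_) (fun a b h => ?_) hab
  · refine subset_closure ?_
    rw [Metric.mem_ball]; linarith [dist_triangle a b q]
  · obtain ⟨m, h1, h2⟩ := hconv.exists_midpoint hlength hcompact h
    refine ⟨m, ?_, ?_, h1, h2⟩
    · linarith [dist_triangle m b q]
    · linarith [dist_triangle_left m q a]

end Limit

/-! ### Refinability from contractions in the space itself and in the approximating spaces -/

theorem eventually_cellOscillationLE {Z : Type*} [MetricSpace Z] {F : ℝ → ℝ → Z}
    (hF : ContinuousOn (Function.uncurry F) (Icc 0 1 ×ˢ Icc 0 1)) {η : ℝ} (hη : 0 < η) :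
    ∀ᶠ N : ℕ in atTop, CellOscillationLE N η F := by
  have huc := (isCompact_Icc.prod isCompact_Icc).uniformContinuousOn_of_continuous hF
  obtain ⟨δ, hδ, h⟩ := Metric.uniformContinuousOn_iff.1 huc η hη
  obtain ⟨N₀, hN₀⟩ := exists_nat_gt (1 / δ)
  filter_upwards [eventually_ge_atTop N₀, eventually_gt_atTop 0] with N hN hN0
  have h0 : (0 : ℝ) < N := by exact_mod_cast hN0
  have h1 : (1 : ℝ) / N < δ := by
    have : (N₀ : ℝ) ≤ N := by exact_mod_cast hN
    rw [div_lt_iff₀ hδ] at hN₀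
    rw [div_lt_iff₀ h0]; nlinarith
  have hd : ∀ i, ∀ s ∈ unitCell N i, ∀ s' ∈ unitCell N i, dist s s' < δ := by
    intro i s hs s' hs'
    refine lt_of_le_of_lt ?_ h1
    have := Real.dist_le_of_mem_Icc hs hs'
    rwa [← sub_div, add_sub_cancel_left] at this
  intro i hi j hj s hs s' hs' t ht t' ht'
  refine (h (s, t) ⟨unitCell_subset hi hs, unitCell_subset hj ht⟩ (s', t')
    ⟨unitCell_subset hi hs', unitCell_subset hj ht'⟩ ?_).le
  exact max_lt (hd i s hs s' hs') (hd j t ht t' ht')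

theorem gridContinuous_of_continuous {Z : Type*} [TopologicalSpace Z] {F : ℝ → ℝ → Z}
    (hF : Continuous (Function.uncurry F)) (N : ℕ) : GridContinuous N F := fun k _ =>
  ⟨(hF.comp (by fun_prop : Continuous fun s : ℝ => (s, (k : ℝ) / N))).continuousOn,
    (hF.comp (by fun_prop : Continuous fun s : ℝ => ((k : ℝ) / N, s))).continuousOn⟩

theorem loopContractibleIn_of_contractibilityModule_lt {X : Type*} [MetricSpace X] {t ε : ℝ} {x : X}
    (h : contractibilityModule t x < ENNReal.ofReal ε) (y : X) (γ : Path y y)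
    (hγ : range γ ⊆ Metric.ball x t) : LoopContractibleIn γ (Metric.ball x ε) := by
  obtain ⟨_, ⟨r, rfl, -, hr⟩, hlt⟩ := sInf_lt_iff.1 h
  obtain ⟨H, hH⟩ := hr y γ hγ
  have hrε : r ≤ ε := by
    by_contra hcon
    exact absurd hlt (not_lt.2 (ENNReal.ofReal_le_ofReal (not_le.1 hcon).le))
  exact ⟨H, fun z => Metric.ball_subset_ball hrε (hH z)⟩

/-- A continuous filling of the whole square serves for every grid at once; uniform continuity makes
its oscillation small on fine cells. -/
theorem refinable_of_loopContractibleIn {Z : Type*} [MetricSpace Z] {z : Z} {δ ε : ℝ}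
    (h : ∀ (y : Z) (γ : Path y y), range γ ⊆ Metric.ball z δ →
      LoopContractibleIn γ (Metric.ball z ε)) : Refinable z δ ε := by
  intro u hu hub η hη
  obtain ⟨F, hF, hFB, hFu⟩ := exists_square_filling h u hu hub
  filter_upwards [eventually_cellOscillationLE hF.continuousOn hη] with N hN
  exact ⟨F, gridContinuous_of_continuous hF N, hN, hFu, fun s _ t _ => hFB s t⟩

theorem ModuleTendsToZero.exists_refinable {Z : Type*} [MetricSpace Z] {z : Z}
    (h : ModuleTendsToZero z) {ε : ℝ} (hε : 0 < ε) : ∃ δ > 0, Refinable z δ ε := by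
  have h1 : ∀ᶠ t : ℝ in 𝓝[>] 0, contractibilityModule t z < ENNReal.ofReal ε :=
    h.eventually (gt_mem_nhds (ENNReal.ofReal_pos.2 hε))
  obtain ⟨t, ht, ht0⟩ := (h1.and self_mem_nhdsWithin).exists
  exact ⟨t, ht0, refinable_of_loopContractibleIn
    (loopContractibleIn_of_contractibilityModule_lt ht)⟩

/-- A curve in the target of an approximation is approximated by a curve in a length space. -/
theorem IsGHApproximation.exists_lift {X Y : Type*} [MetricSpace X] [MetricSpace Y] {p : X} {q : Y}
    {R η : ℝ} {f : X → Y} (hf : IsGHApproximation p q R η f) (hη : 0 < η) (hX : IsLengthSpace X)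
    {c : ℝ → Y} (hc : ContinuousOn c (Icc 0 1)) {ξ : ℝ → X}
    (hξ : ∀ s ∈ Icc (0 : ℝ) 1, ξ s ∈ Metric.ball p R ∧ dist (f (ξ s)) (c s) ≤ η) :
    ∃ g : ℝ → X, ContinuousOn g (Icc 0 1) ∧ g 0 = ξ 0 ∧ g 1 = ξ 1 ∧
      ∀ s ∈ Icc (0 : ℝ) 1, dist (g s) (ξ s) ≤ 9 * η := by
  have hosc := eventually_cellOscillationLE (F := fun s _ => c s)
    (hc.comp continuousOn_fst fun z hz => hz.1) hη
  obtain ⟨N, hN, hN0⟩ := (hosc.and (eventually_gt_atTop 0)).exists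
  have h0 : (0 : ℝ) < N := by exact_mod_cast hN0
  -- Three errors `η` come from the oscillation of `c` and the two approximations `ξ`, a fourth from
  -- the distortion. The joining curves get `5 * η` to make the bound strict, and `5 + 4 = 9`.
  have hξd : ∀ j < N, ∀ s ∈ unitCell N j, ∀ s' ∈ unitCell N j, dist (ξ s) (ξ s') ≤ 4 * η := by
    intro j hj s hs s' hs'
    have h1 := hN j hj 0 hN0 s hs s' hs' _ (left_mem_unitCell hN0 0) _ (left_mem_unitCell hN0 0)
    obtain ⟨a1, a2⟩ := hξ s (unitCell_subset hj hs)
    obtain ⟨b1, b2⟩ := hξ s' (unitCell_subset hj hs')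
    have h2 := abs_le.1 (hf.distortion _ a1 _ b1)
    have h3 := dist_triangle4_right (f (ξ s)) (f (ξ s')) (c s) (c s')
    simp only at h1
    linarith
  obtain ⟨g, hg1, hg2, hg3⟩ := exists_continuous_interpolation (r := 5 * η) (η := 4 * η) hN0 ξ
    (fun j hj s hs => hξd j hj _ (left_mem_unitCell hN0 j) s hs) (fun j hj => by
      have := hξd j hj _ (left_mem_unitCell hN0 j) _ (right_mem_unitCell hN0 j)
      obtain ⟨γ, hγ, -⟩ := hX.exists_path (ξ ((j : ℕ) / N)) (ξ ((j + 1 : ℕ) / N)) (r := 5 * η)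
        (by linarith)
      exact ⟨γ, fun s => (hγ s).le⟩)
  refine ⟨g, hg1, ?_, ?_, fun s hs => (hg3 s hs).trans (by linarith)⟩
  · simpa using hg2 0 (by omega)
  · simpa [div_self h0.ne'] using hg2 N le_rfl

/-- A map of the boundary of the square to the target of an approximation `f` is close to the
`f`-image of a map which extends to the square, if loops of that size contract in the source. -/
theorem IsGHApproximation.exists_filling {X Y : Type*} [MetricSpace X] [MetricSpace Y] {p : X}
    {q : Y} {R η : ℝ} {f : X → Y} (hf : IsGHApproximation p q R η f) (hη : 0 < η)
    (hX : IsLengthSpace X) {x : X} (hx : x ∈ Metric.ball p R) {δ ε : ℝ}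
    (hcontr : ∀ (y : X) (γ : Path y y), range γ ⊆ Metric.ball x (δ + 12 * η) →
      LoopContractibleIn γ (Metric.ball x ε))
    {u : ℝ → ℝ → Y} (hu : GridContinuous 1 u)
    (hux : ∀ s ∈ Icc (0 : ℝ) 1, ∀ t ∈ Icc (0 : ℝ) 1, OnBoundary s t → dist (u s t) (f x) < δ)
    (huq : ∀ s ∈ Icc (0 : ℝ) 1, ∀ t ∈ Icc (0 : ℝ) 1, OnBoundary s t →
      dist (u s t) q + 12 * η < R) :
    ∃ F : ℝ → ℝ → X, Continuous (Function.uncurry F) ∧ (∀ s t, F s t ∈ Metric.ball x ε) ∧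
      ∀ s ∈ Icc (0 : ℝ) 1, ∀ t ∈ Icc (0 : ℝ) 1, OnBoundary s t →
        dist (f (F s t)) (u s t) ≤ 11 * η := by
  have hp : p ∈ Metric.ball p R := Metric.mem_ball_self (dist_nonneg.trans_lt hx)
  have hξ : ∀ s t, ∃ y : X, s ∈ Icc (0 : ℝ) 1 → t ∈ Icc (0 : ℝ) 1 → OnBoundary s t →
      y ∈ Metric.ball p R ∧ dist (f y) (u s t) ≤ η := by
    intro s t
    by_cases h : s ∈ Icc (0 : ℝ) 1 ∧ t ∈ Icc (0 : ℝ) 1 ∧ OnBoundary s t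
    · obtain ⟨y, hy⟩ := hf.almost_onto (u s t) (by
        have := huq s h.1 t h.2.1 h.2.2
        rw [Metric.mem_ball]; linarith)
      exact ⟨y, fun _ _ _ => hy⟩
    · exact ⟨x, fun a b c => absurd ⟨a, b, c⟩ h⟩
  choose ξ hξ using hξ
  have hI0 : (0 : ℝ) ∈ Icc (0 : ℝ) 1 := by simp
  have hI1 : (1 : ℝ) ∈ Icc (0 : ℝ) 1 := by simp
  have h0 := hu 0 (by omega)
  have h1 := hu 1 le_rfl
  simp only [Nat.cast_zero, Nat.cast_one, div_one] at h0 h1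
  obtain ⟨gb, cb, b0, b1, hb⟩ := hf.exists_lift hη hX h0.1 (ξ := fun s => ξ s 0)
    (fun s hs => hξ s 0 hs hI0 (by simp [OnBoundary]))
  obtain ⟨gt, ct, t0, t1, ht⟩ := hf.exists_lift hη hX h1.1 (ξ := fun s => ξ s 1)
    (fun s hs => hξ s 1 hs hI1 (by simp [OnBoundary]))
  obtain ⟨gl, cl, l0, l1, hl⟩ := hf.exists_lift hη hX h0.2 (ξ := fun t => ξ 0 t)
    (fun s hs => hξ 0 s hI0 hs (by simp [OnBoundary]))
  obtain ⟨gr, cr, r0, r1, hr⟩ := hf.exists_lift hη hX h1.2 (ξ := fun t => ξ 1 t)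
    (fun s hs => hξ 1 s hI1 hs (by simp [OnBoundary]))
  classical
  -- The four lifted sides fit together because each lift keeps the values of `ξ` at its endpoints.
  set w : ℝ → ℝ → X := fun s t =>
    if t = 0 then gb s else if t = 1 then gt s else if s = 0 then gl t else gr t with hw
  have wb : ∀ s, w s 0 = gb s := fun s => by simp [hw]
  have wt : ∀ s, w s 1 = gt s := fun s => by simp [hw]
  have wl : ∀ t, w 0 t = gl t := fun t => by
    by_cases h : t = 0
    · rw [h, wb, b0, l0]
    by_cases h' : t = 1
    · rw [h', wt, t0, l1]
    simp [hw, h, h']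
  have wr : ∀ t, w 1 t = gr t := fun t => by
    by_cases h : t = 0
    · rw [h, wb, b1, r0]
    by_cases h' : t = 1
    · rw [h', wt, t1, r1]
    simp [hw, h, h']
  have hwξ : ∀ s ∈ Icc (0 : ℝ) 1, ∀ t ∈ Icc (0 : ℝ) 1, OnBoundary s t →
      dist (w s t) (ξ s t) ≤ 9 * η := by
    intro s hs t ht' hst
    rcases hst with rfl | rfl | rfl | rfl
    · rw [wl]; exact hl t ht'
    · rw [wr]; exact hr t ht'
    · rw [wb]; exact hb s hs
    · rw [wt]; exact ht s hs
  have hwc : GridContinuous 1 w := by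
    intro k hk
    interval_cases k
    · simp only [Nat.cast_zero, Nat.cast_one, div_one]
      exact ⟨cb.congr fun s _ => wb s, cl.congr fun t _ => wl t⟩
    · simp only [Nat.cast_one, div_one]
      exact ⟨ct.congr fun s _ => wt s, cr.congr fun t _ => wr t⟩
  -- The lift is within `9η` of `ξ`; distortion and the error of `ξ` give `11η` in `Y`. Comparing
  -- distances to `x` with those in `Y` costs one more distortion, hence the `12η` in the
  -- contractibility hypothesis.
  have hwf : ∀ s ∈ Icc (0 : ℝ) 1, ∀ t ∈ Icc (0 : ℝ) 1, OnBoundary s t →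
      w s t ∈ Metric.ball p R ∧ dist (f (w s t)) (u s t) ≤ 11 * η := by
    intro s hs t ht' hst
    obtain ⟨a1, a2⟩ := hξ s t hs ht' hst
    have a3 := hwξ s hs t ht' hst
    have a4 := abs_le.1 (hf.distortion _ a1 p hp)
    have a5 := huq s hs t ht' hst
    have a6 := hf.base
    have a7 := dist_triangle4 (f (ξ s t)) (u s t) q (f p)
    rw [dist_comm q] at a7
    have a8 := dist_triangle (w s t) (ξ s t) p
    have hmem : w s t ∈ Metric.ball p R := by rw [Metric.mem_ball]; linarith
    have a9 := abs_le.1 (hf.distortion _ hmem _ a1)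
    have a10 := dist_triangle (f (w s t)) (f (ξ s t)) (u s t)
    exact ⟨hmem, by linarith⟩
  obtain ⟨F, hF, hFB, hFw⟩ := exists_square_filling hcontr w hwc (fun s hs t ht' hst => by
    obtain ⟨a1, a2⟩ := hwf s hs t ht' hst
    have a3 := abs_le.1 (hf.distortion _ a1 x hx)
    have a4 := hux s hs t ht' hst
    have a5 := dist_triangle (f (w s t)) (u s t) (f x)
    rw [Metric.mem_ball]; linarith)
  exact ⟨F, hF, hFB, fun s hs t ht' hst => by
    rw [hFw s hs t ht' hst]; exact (hwf s hs t ht' hst).2⟩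

section Limit

variable {X : ℕ → Type*} {Y : Type*} [∀ i, MetricSpace (X i)] [MetricSpace Y]
  {p : ∀ i, X i} {q : Y} {f : ∀ i, X i → Y}

/-- Every point of the limit ball is a limit of points of the converging balls. -/
theorem GHConvergesOnBall.exists_pointsConverge {R : ℝ} (hconv : GHConvergesOnBall p q R f)
    {z : Y} (hz : z ∈ Metric.ball q R) : ∃ x : ∀ i, X i, PointsConverge p R f x z := by
  have hR : 0 < R := dist_nonneg.trans_lt hz
  -- Almost nearest points, with an error tending to zero, yield one sequence that works for every
  -- `ε`.
  set D : ℕ → Set ℝ := fun i => (fun x => dist (f i x) z) '' Metric.ball (p i) R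
  have hne : ∀ i, (D i).Nonempty := fun i =>
    (Metric.nonempty_ball.2 hR).image _
  have hbdd : ∀ i, BddBelow (D i) := fun i => ⟨0, by rintro _ ⟨x, -, rfl⟩; exact dist_nonneg⟩
  have hch : ∀ i : ℕ, ∃ x ∈ Metric.ball (p i) R, dist (f i x) z < sInf (D i) + 1 / (i + 1) := by
    intro i
    obtain ⟨_, ⟨x, hx, rfl⟩, h⟩ := exists_lt_of_csInf_lt (hne i)
      (lt_add_of_pos_right (sInf (D i)) (Nat.one_div_pos_of_nat (n := i)))
    exact ⟨x, hx, h⟩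
  choose x hx hxd using hch
  refine ⟨x, hx, ?_⟩
  rw [Metric.tendsto_atTop']
  intro ε hε
  have hz' : 0 < R - dist z q := sub_pos.2 hz
  have h1 := hconv (min (ε / 2) ((R - dist z q) / 2)) (lt_min (by linarith) (by linarith))
  have h2 : ∀ᶠ i : ℕ in atTop, 1 / ((i : ℝ) + 1) < ε / 2 :=
    (tendsto_one_div_add_atTop_nhds_zero_nat (𝕜 := ℝ)).eventually (gt_mem_nhds (half_pos hε))
  obtain ⟨N, hN⟩ := eventually_atTop.1 (h1.and h2)
  refine ⟨N, fun i hi => ?_⟩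
  obtain ⟨h3, h4⟩ := hN i hi.le
  obtain ⟨y, hy, hyz⟩ := h3.almost_onto z (by
    have := min_le_right (ε / 2) ((R - dist z q) / 2)
    rw [Metric.mem_ball]; linarith)
  have h5 := csInf_le (hbdd i) ⟨y, hy, rfl⟩
  have := min_le_left (ε / 2) ((R - dist z q) / 2)
  have := hxd i
  simp only at h5
  linarith

/-- Near points which are not of type II, boundary maps can be refined. -/
theorem GHConvergesOnBall.exists_refinable_of_not_isTypeII
    (hconv : GHConvergesOnBall p q 2 f) (hlength : ∀ i, IsLengthSpace (X i))
    (hcompact : ∀ R < 2, IsCompact (Metric.closedBall q R))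
    (hcomplete : IsComplete (closure (Metric.ball q 2))) {z : Y}
    (hz : z ∈ Metric.ball q (3 / 2)) (hII : ¬ IsTypeII p 2 f z) {ε : ℝ} (hε : 0 < ε) :
    ∃ δ > 0, Refinable z δ ε := by
  -- A small `ε` keeps the whole construction inside the balls of radius 2, where the approximations
  -- and geodesics are available.
  wlog hε8 : ε ≤ 1 / 8 generalizing ε
  · obtain ⟨δ, hδ, h⟩ := this (ε := 1 / 8) (by norm_num) le_rfl
    refine ⟨δ, hδ, h.of_dist_le (by simp) ?_⟩
    rw [dist_self]; linarith
  rw [Metric.mem_ball] at hz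
  obtain ⟨x, hx⟩ := hconv.exists_pointsConverge (z := z) (by rw [Metric.mem_ball]; linarith)
  have heq : EquallyContinuousAtZero (fun (i : ℕ) (t : ℝ) => contractibilityModule t (x i)) := by
    by_contra hcon
    exact hII ⟨x, hx, hcon⟩
  obtain ⟨δ₁, hδ₁, heq⟩ := heq (ENNReal.ofReal (ε / 4)) (ENNReal.ofReal_pos.2 (by positivity))
  obtain ⟨t₀, ht₀, ht₀δ, ht₀ε⟩ : ∃ t₀ > 0, t₀ < δ₁ ∧ t₀ ≤ ε :=
    ⟨min (δ₁ / 2) ε, lt_min (by linarith) hε, (min_le_left _ _).trans_lt (by linarith),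
      min_le_right _ _⟩
  have hcontr : ∀ i (y : X i) (γ : Path y y), range γ ⊆ Metric.ball (x i) t₀ →
      LoopContractibleIn γ (Metric.ball (x i) (ε / 2)) := fun i =>
    loopContractibleIn_of_contractibilityModule_lt ((heq i t₀ ht₀.le ht₀δ).trans_lt
      ((ENNReal.ofReal_lt_ofReal_iff (by linarith)).2 (by linarith)))
  refine ⟨t₀ / 2, by linarith, fun u hu hub η hη => ?_⟩
  obtain ⟨θ, hθ, hθη, hθt⟩ : ∃ θ > 0, θ ≤ η / 1000 ∧ θ ≤ t₀ / 1000 :=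
    ⟨min (η / 1000) (t₀ / 1000), lt_min (by positivity) (by positivity), min_le_left _ _,
      min_le_right _ _⟩
  -- The index depends on `η`, but `t₀` does not: equal continuity gives one contractibility scale
  -- for all `i`.
  obtain ⟨i, hi, hiz⟩ := ((hconv θ hθ).and (hx.2.eventually (Metric.ball_mem_nhds z hθ))).exists
  have hxi := hx.1 i
  have hiz : dist (f i (x i)) z < θ := hiz
  have hp : p i ∈ Metric.ball (p i) 2 := by simp
  have huq : ∀ s ∈ Icc (0 : ℝ) 1, ∀ t ∈ Icc (0 : ℝ) 1, OnBoundary s t →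
      dist (u s t) q < 3 / 2 + 1 / 16 := fun s hs t ht hst => by
    linarith [hub s hs t ht hst, dist_triangle (u s t) z q]
  obtain ⟨F, hF, hFB, hFu⟩ := hi.exists_filling hθ (hlength i) hxi (δ := t₀ / 2 + θ) (ε := ε / 2)
    (fun y γ hγ => hcontr i y γ (hγ.trans (Metric.ball_subset_ball (by linarith)))) hu
    (fun s hs t ht hst => by
      linarith [hub s hs t ht hst, dist_triangle_right (u s t) (f i (x i)) z])
    (fun s hs t ht hst => by linarith [huq s hs t ht hst])
  have hxp : dist (x i) (p i) ≤ 3 / 2 + 3 * θ := by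
    have h1 := abs_le.1 (hi.distortion _ hxi _ hp)
    have h2 := dist_triangle4 (f i (x i)) z q (f i (p i))
    rw [dist_comm q] at h2
    linarith [hi.base]
  have hFp : ∀ s t, F s t ∈ Metric.ball (p i) 2 := fun s t => by
    have h1 := hFB s t
    rw [Metric.mem_ball] at h1 ⊢
    linarith [dist_triangle (F s t) (x i) (p i)]
  have hFz : ∀ s t, dist (f i (F s t)) z ≤ ε / 2 + 2 * θ := fun s t => by
    have h1 := abs_le.1 (hi.distortion _ (hFp s t) _ hxi)
    have h2 := hFB s t
    rw [Metric.mem_ball] at h2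
    linarith [dist_triangle (f i (F s t)) (f i (x i)) z]
  classical
  set G : ℝ → ℝ → Y := fun s t => if OnBoundary s t then u s t else f i (F s t) with hG
  have hGu : ∀ s t, OnBoundary s t → G s t = u s t := fun s t h => if_pos h
  have hGF : ∀ s ∈ Icc (0 : ℝ) 1, ∀ t ∈ Icc (0 : ℝ) 1, dist (G s t) (f i (F s t)) ≤ 11 * θ := by
    intro s hs t ht
    by_cases h : OnBoundary s t
    · rw [hGu s t h, dist_comm]; exact hFu s hs t ht h
    · simp only [hG, if_neg h, dist_self]; positivity
  have hGz : ∀ s ∈ Icc (0 : ℝ) 1, ∀ t ∈ Icc (0 : ℝ) 1, dist (G s t) z ≤ ε / 2 + 2 * θ := by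
    intro s hs t ht
    by_cases h : OnBoundary s t
    · rw [hGu s t h]; linarith [hub s hs t ht h]
    · simp only [hG, if_neg h]; exact hFz s t
  have hGc : GridContinuous 1 G := by
    intro k hk
    have hk' : (k : ℝ) / (1 : ℕ) = 0 ∨ (k : ℝ) / (1 : ℕ) = 1 := by
      interval_cases k <;> simp
    refine ⟨(hu k hk).1.congr fun s _ => if_pos ?_, (hu k hk).2.congr fun s _ => if_pos ?_⟩
    · exact hk'.elim (fun h => .inr (.inr (.inl h))) (fun h => .inr (.inr (.inr h)))
    · exact hk'.elim (fun h => .inl h) (fun h => .inr (.inl h))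
  filter_upwards [eventually_cellOscillationLE hF.continuousOn hθ, eventually_gt_atTop 0]
    with N hN hN0
  -- Twice `11θ` for changing `f i ∘ F` to `G`, and `θ` each for the oscillation of `F` and the
  -- distortion.
  have hGo : CellOscillationLE N (24 * θ) G := by
    intro a ha b hb s hs s' hs' t ht t' ht'
    have h1 := hN a ha b hb s hs s' hs' t ht t' ht'
    have h2 := hGF s (unitCell_subset ha hs) t (unitCell_subset hb ht)
    have h3 := hGF s' (unitCell_subset ha hs') t' (unitCell_subset hb ht')
    have h4 := abs_le.1 (hi.distortion _ (hFp s t) _ (hFp s' t'))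
    have h5 := dist_triangle4 (G s t) (f i (F s t)) (f i (F s' t')) (G s' t')
    rw [dist_comm (f i (F s' t')) (G s' t')] at h5
    linarith
  -- Geodesics restore continuity on the grid lines only; `v` is within `48θ` of `G`, so its
  -- oscillation is at most `48θ + 24θ + 48θ = 120θ ≤ η`.
  obtain ⟨v, hv1, hv2, hv3⟩ := exists_gridContinuous hN0 (r := 24 * θ) (by positivity) G hGc hGo
    (fun s hs t ht s' hs' t' ht' hd => by
      obtain ⟨γ, hγ⟩ := hconv.exists_geodesic hlength hcompact hcomplete (a := G s t)
        (b := G s' t') (by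
          linarith [hGz s hs t ht, hGz s' hs' t' ht', dist_triangle (G s t) z q,
            dist_triangle (G s' t') z q])
      exact ⟨γ, fun x => (hγ x).trans hd⟩)
  refine ⟨v, hv1, ?_, fun s hs t ht hst => by rw [hv2 s hs t ht hst, hGu s t hst],
    fun s hs t ht => ?_⟩
  · intro a ha b hb s hs s' hs' t ht t' ht'
    have h1 := hGo a ha b hb s hs s' hs' t ht t' ht'
    have h2 := hv3 s (unitCell_subset ha hs) t (unitCell_subset hb ht)
    have h3 := hv3 s' (unitCell_subset ha hs') t' (unitCell_subset hb ht')
    have h5 := dist_triangle4 (v s t) (G s t) (G s' t') (v s' t')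
    rw [dist_comm (G s' t') (v s' t')] at h5
    linarith
  · linarith [hv3 s hs t ht, hGz s hs t ht, dist_triangle (v s t) (G s t) z]

end Limit

/-! ### From fillings of squares to the module of contractibility -/

/-- Small loops contract when the maps of the boundary of the square extend. -/
theorem moduleTendsToZero_of_filling {Z : Type*} [MetricSpace Z] {y : Z} {R₀ : ℝ} (hR₀ : 0 < R₀)
    (h : ∀ R > 0, R ≤ R₀ → ∃ δ > 0, ∀ u : ℝ → ℝ → Z, GridContinuous 1 u →
      (∀ s ∈ Icc (0 : ℝ) 1, ∀ t ∈ Icc (0 : ℝ) 1, OnBoundary s t → dist (u s t) y < δ) →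
      ∃ V : ℝ → ℝ → Z, ContinuousOn (Function.uncurry V) (Icc 0 1 ×ˢ Icc 0 1) ∧
        (∀ s ∈ Icc (0 : ℝ) 1, ∀ t ∈ Icc (0 : ℝ) 1, OnBoundary s t → V s t = u s t) ∧
        ∀ s ∈ Icc (0 : ℝ) 1, ∀ t ∈ Icc (0 : ℝ) 1, dist (V s t) y ≤ R) :
    ModuleTendsToZero y := by
  rw [ModuleTendsToZero, ENNReal.tendsto_nhds_zero]
  intro ε hε
  obtain ⟨R, hR, hRR₀, hRε⟩ : ∃ R > 0, R ≤ R₀ ∧ ENNReal.ofReal (2 * R) ≤ ε := by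
    rcases eq_or_ne ε ⊤ with rfl | hne
    · exact ⟨R₀, hR₀, le_rfl, le_top⟩
    · have := ENNReal.toReal_pos hε.ne' hne
      refine ⟨min R₀ (ε.toReal / 2), lt_min hR₀ (by positivity), min_le_left _ _, ?_⟩
      rw [← ENNReal.ofReal_toReal hne]
      exact ENNReal.ofReal_le_ofReal (by
        have := min_le_right R₀ (ε.toReal / 2); rw [ENNReal.ofReal_toReal hne]; linarith)
  obtain ⟨δ, hδ, hfill⟩ := h R hR hRR₀
  filter_upwards [Ioo_mem_nhdsGT (lt_min hδ hR)] with t ht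
  obtain ⟨ht0, ht⟩ := ht
  have htδ := ht.trans_le (min_le_left _ _)
  have htR := ht.trans_le (min_le_right _ _)
  -- The factor 2 puts the closed `R`-ball, which contains the filling, inside an open ball.
  refine le_trans (sInf_le ⟨2 * R, rfl, by linarith, fun b γ hγ => ?_⟩) hRε
  have hγ' : ∀ s, dist (γ s) y < δ := fun s =>
    (Metric.mem_ball.1 (hγ (mem_range_self s))).trans htδ
  have hb : dist b y < δ := by simpa using hγ' 0
  classical
  -- The loop on the bottom side and its base point on the other three: a filling is then a
  -- contraction relative to the base point.
  set u : ℝ → ℝ → Z := fun s t => if t = 0 then γ.extend s else b with hu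
  have u0 : ∀ t, u 0 t = b := fun t => by simp only [hu, γ.extend_zero, ite_self]
  have u1 : ∀ t, u 1 t = b := fun t => by simp only [hu, γ.extend_one, ite_self]
  obtain ⟨V, hV, hVu, hVd⟩ := hfill u (fun k hk => by
      interval_cases k
      · simp only [Nat.cast_zero, Nat.cast_one, div_one]
        refine ⟨?_, by simp only [u0]; exact continuousOn_const⟩
        simp only [hu, if_true]; exact γ.continuous_extend.continuousOn
      · simp only [Nat.cast_one, div_one]
        refine ⟨?_, by simp only [u1]; exact continuousOn_const⟩
        simp only [hu, one_ne_zero, if_false]; exact continuousOn_const)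
    (fun s _ t _ _ => by
      by_cases h : t = 0
      · simp only [hu, if_pos h]; exact hγ' _
      · simp only [hu, if_neg h]; exact hb)
  have hVc : Continuous fun z : I × I => V z.2 z.1 :=
    hV.comp_continuous (f := fun z : I × I => ((z.2 : ℝ), (z.1 : ℝ))) (by fun_prop)
      fun z => ⟨z.2.2, z.1.2⟩
  have hI0 : (0 : ℝ) ∈ Icc (0 : ℝ) 1 := by simp
  have hI1 : (1 : ℝ) ∈ Icc (0 : ℝ) 1 := by simp
  have V0 : ∀ t : I, V 0 t = b := fun t => by
    rw [hVu 0 hI0 t t.2 (.inl rfl), u0]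
  have V1 : ∀ t : I, V 1 t = b := fun t => by
    rw [hVu 1 hI1 t t.2 (.inr (.inl rfl)), u1]
  refine ⟨⟨⟨⟨fun z => V z.2 z.1, hVc⟩, fun s => ?_, fun s => ?_⟩, fun t s hs => ?_⟩, fun z => ?_⟩
  · change V s 0 = γ s
    rw [hVu s s.2 0 hI0 (.inr (.inr (.inl rfl)))]
    simp [hu, Path.extend_apply _ s.2]
  · change V s 1 = b
    rw [hVu s s.2 1 hI1 (.inr (.inr (.inr rfl)))]
    simp [hu]
  · rcases hs with rfl | rfl
    · change V 0 t = γ 0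
      rw [V0, γ.source]
    · change V 1 t = γ 1
      rw [V1, γ.target]
  · exact Metric.mem_ball.2 ((hVd z.2 z.2.2 z.1 z.1.2).trans_lt (by linarith))

end RicciLimit

/-! ### Conclusion of the argument -/

theorem mainTheorem7 {X : ℕ → Type*} {Y : Type*} [∀ i, MetricSpace (X i)] [MetricSpace Y]
    (p : ∀ i, X i) (q : Y) (f : ∀ i, X i → Y)
    (hlength : ∀ i, RicciLimit.IsLengthSpace (X i))
    (hcompact : ∀ i, IsCompact (closure (Metric.ball (p i) 2)))
    (hcomplete : IsComplete (closure (Metric.ball q 2)))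
    (hconv : RicciLimit.GHConvergesOnBall p q 2 f)
    (htypeII : ∀ y ∈ Metric.ball q (3 / 2), RicciLimit.IsTypeII p 2 f y →
      RicciLimit.ModuleTendsToZero y) :
    (∀ y ∈ Metric.ball q 1, RicciLimit.IsTypeIII p 2 f y → RicciLimit.ModuleTendsToZero y) ∧
    (∀ y ∈ Metric.ball q 1, RicciLimit.ModuleTendsToZero y) := by
  have hK : ∀ R < 2, IsCompact (Metric.closedBall q R) := fun R hR =>
    hconv.isCompact_closedBall hcompact hcomplete hR
  -- This ball contains the `1 / 4`-ball around every point of `B_1(q)` and lies in `B_{3/2}(q)`,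
  -- where the type II hypothesis applies.
  have hK0 := hK (5 / 4) (by norm_num)
  have key : ∀ y ∈ Metric.ball q 1, RicciLimit.ModuleTendsToZero y := by
    intro y hy
    refine RicciLimit.moduleTendsToZero_of_filling (R₀ := 1 / 4) (by norm_num) fun R hR hR4 =>
      RicciLimit.exists_filling_of_refinable hK0.isComplete
        (fun ε hε => RicciLimit.exists_uniform_refinable hK0 (fun z hz ε hε => ?_) hε) hR
        (Metric.closedBall_subset_closedBall' ?_)
    · have hz' : z ∈ Metric.ball q (3 / 2) :=
        Metric.closedBall_subset_ball (by norm_num) hz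
      by_cases hII : RicciLimit.IsTypeII p 2 f z
      · exact (htypeII z hz' hII).exists_refinable hε
      · exact hconv.exists_refinable_of_not_isTypeII hlength hK hcomplete hz' hII hε
    · rw [Metric.mem_ball] at hy; linarith
  exact ⟨fun y hy _ => key y hy, key⟩
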